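/- A binary cellular automaton (CA) is a map $f:\{0,1\}^{\mathbb{Z}^2}\to\{0,1\}^{\mathbb{Z}^2}$ of the form $f(x)_{v}=F\big((x_{v+n})_{n\in N}\big)$ for a finite neighborhood $N\subset\mathbb{Z}^2$ and a local rule $F:\{0,1\}^N\to\{0,1\}$; it is freezing if $x\le f(x)$ cellwise for every configuration $x$ (with $0<1$). For a Borel probability measure $\mu$ on $\{0,1\}^{\mathbb{Z}^2}$, let $f^n(\mu)(X)=\mu(f^{-n}(X))$, and let $\Omega_f^\mu$ be the closure of the union of the supports of all weak-$*$ limit points of the sequence $(f^n(\mu))_{n\in\mathbb{N}}$. The CA $f$ trivializes $\mu$ if $|\Omega_f^\mu|=1$. For $p\in[0,1]$ let $\mu_p$ be the Bernoulli (product) measure under which each cell independently has state $1$ with probability $p$; it is nontrivial if $0<p<1$. **Theorem.** The problem of whether a given binary freezing CA trivializes some nontrivial Bernoulli measure is undecidable. That is, there is no algorithm which, given a finite neighborhood $N\subset\mathbb{Z}^2$ and the table of a local rule $F:\{0,1\}^N\to\{0,1\}$ such that the resulting CA $f$ is freezing, always halts and correctly answers whether there is $p\in(0,1)$ such that $f$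 trivializes $\mu_p$. (The algorithm is not required to do anything on inputs whose CA is not freezing.) -/

import Mathlib

open MeasureTheory Filter Topology

/-- Binary configurations on the two-dimensional lattice, with the product topology, the product
(that is, Borel) σ-algebra and the cellwise order, where `false` (`0`) is below `true` (`1`). -/
abbrev Config : Type := ℤ × ℤ → Bool

/-- A binary two-dimensional cellular automaton: a finite neighborhood and a local rule. -/
structure CellularAutomaton where
  nbhd : Finset (ℤ × ℤ)
  rule : (nbhd → Bool) → Bool

namespace CellularAutomaton

/-- The global map: the new state of the cell `v` is the local rule applied to the pattern
`n ↦ x (v + n)` seen through the neighborhood. -/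
def step (f : CellularAutomaton) (x : Config) : Config :=
  fun v => f.rule fun n => x (v + n.1)

theorem measurable_step (f : CellularAutomaton) : Measurable f.step := by
  refine measurable_pi_lambda _ fun v => ?_
  have h : Measurable fun x : Config => fun n : f.nbhd => x (v + n.1) :=
    measurable_pi_lambda _ fun n => measurable_pi_apply _
  exact (measurable_of_finite f.rule).comp h

/-- A cellular automaton is freezing if `x ≤ f x` for every configuration `x`. -/
def Freezing (f : CellularAutomaton) : Prop :=
  ∀ x : Config, x ≤ f.step x

/-- The image measure `fⁿ(μ) : X ↦ μ (f⁻ⁿ X)`. -/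
noncomputable def iterMap (f : CellularAutomaton) (n : ℕ) (μ : ProbabilityMeasure Config) :
    ProbabilityMeasure Config :=
  μ.map (f := f.step^[n]) (f.measurable_step.iterate n).aemeasurable

/-- The `μ`-limit set of `f`: the closure of the union of the supports of all limit points, for
weak convergence, of the sequence `(fⁿ(μ))`. -/
def limitSet (f : CellularAutomaton) (μ : ProbabilityMeasure Config) : Set Config :=
  closure (⋃ ν ∈ {ν : ProbabilityMeasure Config | MapClusterPt ν atTop fun n => f.iterMap n μ},
    (ν : Measure Config).support)

/-- `f` trivializes `μ` if its `μ`-limit set has exactly one element. -/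
def Trivializes (f : CellularAutomaton) (μ : ProbabilityMeasure Config) : Prop :=
  (f.limitSet μ).encard = 1

end CellularAutomaton

/-- The Bernoulli measure `μ_p`: the cells are independent and `1` with probability `p`. -/
noncomputable def bernoulliConfig (p : unitInterval) : ProbabilityMeasure Config :=
  ⟨Measure.infinitePi fun _ : ℤ × ℤ => ProbabilityTheory.bernoulliMeasure true false p,
    inferInstance⟩

/-- `f` trivializes some Bernoulli measure `μ_p` with `0 < p < 1`. -/
def CellularAutomaton.TrivializesSomeBernoulli (f : CellularAutomaton) : Prop :=
  ∃ p : unitInterval, 0 < p ∧ p < 1 ∧ f.Trivializes (bernoulliConfig p)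

/-- Finite descriptions of cellular automata: a list of the vectors of the neighborhood and a list
of the words, read along the first list, on which the local rule takes the value `1`. -/
abbrev CACode : Type := List (ℤ × ℤ) × List (List Bool)

/-- The cellular automaton that a finite description denotes. -/
def CACode.toCA (c : CACode) : CellularAutomaton where
  nbhd := c.1.toFinset
  rule w := decide ((c.1.attach.map fun n => w ⟨n.1, List.mem_toFinset.2 n.2⟩) ∈ c.2)

/-- Every cellular automaton has a finite description. -/
theorem CACode.exists_toCA_eq (f : CellularAutomaton) : ∃ c : CACode, c.toCA = f := by
  classical
  obtain ⟨N, F⟩ := f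
  let word : (N → Bool) → List Bool := fun w =>
    N.toList.attach.map fun n => w ⟨n.1, Finset.mem_toList.1 n.2⟩
  have hword : Function.Injective word := by
    intro w w' h
    funext n
    have := List.map_inj_left.1 h ⟨n.1, Finset.mem_toList.2 n.2⟩ (List.mem_attach _ _)
    simpa using this
  refine ⟨(N.toList, ((Finset.univ.filter fun w => F w = true).image word).toList), ?_⟩
  have key : ∀ (M : Finset (ℤ × ℤ)) (hM : M = N) (G : (M → Bool) → Bool),
      (∀ w : N → Bool, G (fun n => w ⟨n.1, hM ▸ n.2⟩) = F w) →
      CellularAutomaton.mk M G = ⟨N, F⟩ := by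
    rintro M rfl G h
    congr
    funext w
    exact h w
  refine key _ (by simp) _ fun w => ?_
  rw [Bool.eq_iff_iff, decide_eq_true_iff, Finset.mem_toList, Finset.mem_image]
  constructor
  · rintro ⟨w', h', e⟩
    rw [← hword (a₁ := w') (a₂ := w) e]
    exact (Finset.mem_filter.1 h').2
  · intro h
    exact ⟨w, by simpa using h, rfl⟩

/-- The decision problem "given `a` in `I`, does `P a` hold?" is decidable: some algorithm halts
with the correct answer on every instance `a` in `I`; nothing is asked of it outside `I`. -/
def DecidableOn {α : Type*} [Primcodable α] (I : Set α) (P : α → Prop) : Prop :=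
  ∃ D : α →. Bool, Partrec D ∧ ∀ a ∈ I, ∃ b ∈ D a, (b = true ↔ P a)

/-! A freezing automaton trivializes some nontrivial Bernoulli measure if and only if it has no
fixed point whose set of zeros is finite and nonempty. Orbits increase to a limit configuration, so
the limit set is the support of the law of that limit (`Freezing.limitSet_eq_support`). If such a
fixed point exists, then for every p in (0,1) a copy of it occurs at a given place with positive
probability and its zeros persist, while a cell may also start as 1; so the limit takes both values
there (`Freezing.not_trivializes`). If there is none, every zero of a limit configuration starts
arbitrarily long self-avoiding paths of zeros, and a Peierls count excludes this almost surely once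
p is close to 1 (`Freezing.trivializesSomeBernoulli`).

It remains to make the existence of such fixed points undecidable. Their zeros encode finite
pictures: space-time diagrams of a fixed one-dimensional automaton that simulates a Turing machine,
with the input in the bottom row, in which a letter with none of the three cells above it occupied
must be halted. Runs of zeros of various lengths stand for letters, and a run that violates a local
constraint is eaten from its left end. A picture exists precisely when the machine halts
(`exists_isCorrectPicture`, `IsCorrectPicture.exists_mem`). The input n enters only through the
displacement of one window of the neighborhood, which forces the seed to have length n + 2; the rule
table does not depend on n. -/

section

open Turing

/-! ### Undecidable halting for a one-dimensional automaton started from seed rows. -/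

/-- The numbers `1, 3, 7, …` whose binary expansion consists of ones. -/
def binaryOnes : ℕ → ℕ
  | 0 => 1
  | n + 1 => 2 * binaryOnes n + 1

theorem le_binaryOnes (n : ℕ) : n ≤ binaryOnes n := by
  induction n with
  | zero => simp
  | succ n ih => simp only [binaryOnes]; omega

theorem binaryOnes_injective : Function.Injective binaryOnes := by
  refine (strictMono_nat_of_lt_succ fun n => ?_).injective
  simp only [binaryOnes]; omega

theorem primrec_binaryOnes : Primrec binaryOnes := by
  have h : Primrec₂ fun (_ : ℕ) (m : ℕ) => 2 * m + 1 :=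
    (Primrec.nat_add.comp (Primrec.nat_mul.comp (Primrec.const 2) Primrec.snd)
      (Primrec.const 1)).to₂
  refine (Primrec.nat_rec₁ 1 h).of_eq fun n => ?_
  induction n with
  | zero => rfl
  | succ n ih => simp only [binaryOnes, ← ih]

/-- A program that is fed `binaryOnes n` uses this inverse to recover `n`. The search can be bounded
by `m` because `k ≤ binaryOnes k`. -/
theorem exists_computable_leftInverse_binaryOnes :
    ∃ h : ℕ → ℕ, Computable h ∧ ∀ n, h (binaryOnes n) = n := by
  refine ⟨fun m => m.findGreatest fun k => binaryOnes k = m,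
    (Primrec.nat_findGreatest (p := fun m k => binaryOnes k = m) Primrec.id
      (PrimrecRel.comp (R := fun a b : ℕ => a = b) Primrec.eq
        (primrec_binaryOnes.comp Primrec.snd) Primrec.fst)).to_comp, fun n => ?_⟩
  exact binaryOnes_injective
    (Nat.findGreatest_spec (P := fun k => binaryOnes k = binaryOnes n) (le_binaryOnes n) rfl)

/-- With all digits equal, the input is a block of one repeated letter, the only shape that a seed
row can show. -/
theorem trNat_binaryOnes (n : ℕ) :
    PartrecToTM2.trNat (binaryOnes n) = List.replicate (n + 1) PartrecToTM2.Γ'.bit1 := by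
  suffices ∃ p, ((binaryOnes n : ℕ) : Num) = Num.pos p ∧
      PartrecToTM2.trPosNum p = List.replicate (n + 1) PartrecToTM2.Γ'.bit1 by
    obtain ⟨p, hp, h⟩ := this
    rw [PartrecToTM2.trNat, hp, ← h]; rfl
  induction n with
  | zero => exact ⟨PosNum.one, by simp [binaryOnes]; rfl, rfl⟩
  | succ n ih =>
    obtain ⟨p, hp, h⟩ := ih
    refine ⟨p.bit1, ?_, by rw [PartrecToTM2.trPosNum, h]; rfl⟩
    simp only [binaryOnes, Nat.cast_add, Nat.cast_mul, hp, Nat.cast_one]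
    rw [Nat.cast_ofNat, two_mul, Num.bit1_of_bit1]
    rfl

/-- There is a code in Mathlib's basis for partial recursive functions whose halting set
on the inputs `binaryOnes n` is undecidable. -/
theorem exists_toPartrec_code_undecidable :
    ∃ c : ToPartrec.Code, ¬ ComputablePred fun n => (c.eval [binaryOnes n]).Dom := by
  obtain ⟨h, hh, hinv⟩ := exists_computable_leftInverse_binaryOnes
  have hf : Partrec fun m : ℕ => Nat.Partrec.Code.eval (Denumerable.ofNat _ (h m)) 0 :=
    Nat.Partrec.Code.eval_part.comp ((Computable.ofNat _).comp hh) (Computable.const 0)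
  obtain ⟨c, hc⟩ := ToPartrec.Code.exists_code (Nat.Partrec'.part_iff₁.2 hf)
  refine ⟨c, fun ⟨_, H⟩ => ComputablePred.halting_problem 0 ?_⟩
  refine ComputablePred.of_eq
    (p := fun d : Nat.Partrec.Code => (c.eval [binaryOnes (Encodable.encode d)]).Dom)
    ⟨fun d => inferInstance, H.comp Computable.encode⟩ fun d => ?_
  have := hc ⟨[binaryOnes (Encodable.encode d)], rfl⟩
  simp only at this
  rw [this]
  simp [hinv, List.Vector.head]

/-- There is a Turing machine with a finite alphabet and a finite set of accessible states,
together with two letters, whose halting set on the words `x yⁿ⁺¹` is undecidable. -/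
theorem exists_supported_tm0_undecidable :
    ∃ (Γ Λ : Type) (_ : Finite Γ) (_ : Inhabited Γ) (_ : Inhabited Λ) (M : TM0.Machine Γ Λ)
      (S : Set Λ) (x y : Γ), S.Finite ∧ TM0.Supports M S ∧
      ¬ ComputablePred fun n => (TM0.eval M (x :: List.replicate (n + 1) y)).Dom := by
  obtain ⟨c, hc⟩ := exists_toPartrec_code_undecidable
  -- The machine starts in its default state, so the default is set to the entry point of the
  -- program `c`.
  let _ : Inhabited PartrecToTM2.Λ' := ⟨PartrecToTM2.trNormal c PartrecToTM2.Cont'.halt⟩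
  have : Fintype PartrecToTM2.K' := ⟨{.main, .rev, .aux, .stack}, by intro x; cases x <;> simp⟩
  let M₁ := TM2to1.tr PartrecToTM2.tr
  have hS := TM1to0.tr_supports M₁ (TM2to1.tr_supports PartrecToTM2.tr
    (PartrecToTM2.tr_supports c PartrecToTM2.Cont'.halt))
  refine ⟨_, _, inferInstance, inferInstance, inferInstance, TM1to0.tr M₁, _,
    (true, Function.update (fun _ => none) PartrecToTM2.K'.main (some PartrecToTM2.Γ'.cons)),
    (false, Function.update (fun _ => none) PartrecToTM2.K'.main (some PartrecToTM2.Γ'.bit1)),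
    Finset.finite_toSet _, hS, fun H => hc (H.of_eq fun n => ?_)⟩
  rw [TM1to0.tr_eval]
  have e : TM2to1.trInit (Γ := fun _ : PartrecToTM2.K' => PartrecToTM2.Γ') PartrecToTM2.K'.main (PartrecToTM2.trList [binaryOnes n]) =
    (true, Function.update (fun _ => none) PartrecToTM2.K'.main (some PartrecToTM2.Γ'.cons)) ::
    List.replicate (n + 1)
    (false, Function.update (fun _ => none) PartrecToTM2.K'.main (some PartrecToTM2.Γ'.bit1)) := by
    simp only [TM2to1.trInit, PartrecToTM2.trList, trNat_binaryOnes, List.reverse_append,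
      List.reverse_cons, List.reverse_nil, List.nil_append, List.reverse_replicate,
      List.singleton_append]
    exact congrArg (List.cons _) List.map_replicate
  refine (iff_of_eq (congrArg (fun l => (TM1.eval M₁ l).Dom) e.symm)).trans ?_
  refine (TM2to1.tr_eval_dom _ _ _).trans ?_
  have := PartrecToTM2.tr_eval c [binaryOnes n]
  have h2 : (TM2.init PartrecToTM2.K'.main (PartrecToTM2.trList [binaryOnes n]) :
      PartrecToTM2.Cfg') = PartrecToTM2.init c [binaryOnes n] := by
    unfold TM2.init PartrecToTM2.init
    congr
    funext k
    cases k <;> rfl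
  change (StateTransition.eval (TM2.step PartrecToTM2.tr) (TM2.init _ _)).Dom ↔ _
  rw [h2, this]
  rfl

/-- There is a finite Turing machine, together with two letters, whose halting set on the words
`x yⁿ⁺¹` is undecidable. -/
theorem exists_finite_tm0_undecidable :
    ∃ (Γ Λ : Type) (_ : Finite Γ) (_ : Finite Λ) (_ : Inhabited Γ) (_ : Inhabited Λ)
      (M : TM0.Machine Γ Λ) (x y : Γ),
      ¬ ComputablePred fun n => (TM0.eval M (x :: List.replicate (n + 1) y)).Dom := by
  classical
  obtain ⟨Γ, Λ, _, _, _, M, S, x, y, hfin, hS, H⟩ := exists_supported_tm0_undecidable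
  let _ : Inhabited S := ⟨⟨default, hS.1⟩⟩
  let f : PointedMap Γ Γ := ⟨id, rfl⟩
  -- Computations never leave `S`, so the value given to states outside `S` is immaterial.
  let g₁ : PointedMap Λ S := ⟨fun q => if h : q ∈ S then ⟨q, h⟩ else default, dif_pos hS.1⟩
  refine ⟨Γ, S, inferInstance, hfin, inferInstance, inferInstance,
    M.map f f g₁ Subtype.val, x, y, fun h => H (h.of_eq fun n => ?_)⟩
  have hr := TM0.Machine.map_respects M f f g₁ Subtype.val hS (fun _ => rfl)
    (fun q hq => congrArg Subtype.val (dif_pos hq))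
  refine StateTransition.tr_eval_dom hr ⟨hS.1, ?_⟩
  rw [TM0.map_init, show (f : Γ → Γ) = id from rfl, List.map_id]

/-- The evolution of a row under the one-dimensional local rule `F` of radius `1`. -/
def rowRun {A : Type*} (F : A → A → A → A) (c : ℤ → A) : ℕ → ℤ → A
  | 0 => c
  | t + 1 => fun i => F (rowRun F c t (i - 1)) (rowRun F c t i) (rowRun F c t (i + 1))

/-- The row `… b b x y y … y b b …` with `x` at the origin, followed by `n + 1` letters `y`. -/
def seedRow {A : Type*} (b x y : A) (n : ℕ) (i : ℤ) : A :=
  if i = 0 then x else if 0 < i ∧ i ≤ n + 1 then y else b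

namespace Turing.TM0

variable {Γ Λ : Type*} [Inhabited Λ]

/-- The state with which the head of the machine leaves a cell in the direction `d`, if it does. -/
def departing (M : Machine Γ Λ) (d : Dir) (c : Γ × Option Λ) : Option Λ :=
  match c.2 with
  | none => none
  | some q =>
    match M q c.1 with
    | some (q', Stmt.move d') => if d' = d then some q' else none
    | _ => none

/-- The local rule of the one-dimensional cellular automaton that simulates a Turing machine. -/
def rowRule (M : Machine Γ Λ) (l c r : Γ × Option Λ) : Γ × Option Λ :=
  match c.2 with
  | none => (c.1, (departing M Dir.right l).or (departing M Dir.left r))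
  | some q =>
    match M q c.1 with
    | none => c
    | some (q', Stmt.write a) => (a, some q')
    | some (_, Stmt.move _) => (c.1, none)

/-- The cells at which the machine has halted. -/
def haltedCells (M : Machine Γ Λ) : Set (Γ × Option Λ) :=
  {c | ∃ q, c.2 = some q ∧ M q c.1 = none}

theorem rowRule_mem_haltedCells (M : Machine Γ Λ) {c : Γ × Option Λ} (l r : Γ × Option Λ)
    (h : c ∈ haltedCells M) : rowRule M l c r ∈ haltedCells M := by
  obtain ⟨q, hq, hM⟩ := h
  have : rowRule M l c r = c := by simp [rowRule, hq, hM]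
  rw [this]; exact ⟨q, hq, hM⟩

variable [Inhabited Γ]

/-- The row of cells that shows the configuration `s` with its head at `h`. -/
def cfgRow (s : Cfg Γ Λ) (h i : ℤ) : Γ × Option Λ :=
  (s.Tape.nth (i - h), if i = h then some s.q else none)

theorem cfgRow_step (M : Machine Γ Λ) {s s' : Cfg Γ Λ} (hs : step M s = some s') (h : ℤ) :
    ∃ h', ∀ i, rowRule M (cfgRow s h (i - 1)) (cfgRow s h i) (cfgRow s h (i + 1)) =
      cfgRow s' h' i := by
  obtain ⟨q, T⟩ := s
  simp only [step, Option.map_eq_some_iff] at hs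
  obtain ⟨⟨q', a⟩, hM, rfl⟩ := hs
  cases a with
  | write a =>
    refine ⟨h, fun i => ?_⟩
    by_cases hi : i = h
    · subst hi; simp [cfgRow, rowRule, hM, Tape.write]
    · have : i - h ≠ 0 := by omega
      by_cases h1 : i - 1 = h <;> by_cases h2 : i + 1 = h <;>
      simp [cfgRow, rowRule, departing, hi, this, h1, h2, hM]
  | move d =>
    refine ⟨match d with | Dir.left => h - 1 | Dir.right => h + 1, fun i => ?_⟩
    have hl : i - (h - 1) - 1 = i - h := by ring
    have hr : i - (h + 1) + 1 = i - h := by ring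
    by_cases hi : i = h
    · subst hi; cases d <;> simp [cfgRow, rowRule, hM]; omega
    · have hdep : ∀ e j, departing M e (cfgRow ⟨q, T⟩ h j) =
          if j = h ∧ d = e then some q' else none := by
        intro e j
        by_cases hj : j = h
        · subst hj; simp [cfgRow, departing, hM]
        · simp [cfgRow, departing, hj]
      have hnone : (cfgRow ⟨q, T⟩ h i).2 = none := if_neg hi
      simp only [rowRule, hnone, hdep]
      refine Prod.ext ?_ ?_
      · cases d <;> simp [cfgRow, hl, hr]
      · have e1 : (i - 1 = h) = (i = h + 1) := by rw [sub_eq_iff_eq_add]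
        have e2 : (i + 1 = h) = (i = h - 1) := by rw [eq_sub_iff_add_eq]
        cases d <;> simp [cfgRow, e1, e2]

theorem cfgRow_halted (M : Machine Γ Λ) {s : Cfg Γ Λ} (hs : step M s = none) (h i : ℤ) :
    rowRule M (cfgRow s h (i - 1)) (cfgRow s h i) (cfgRow s h (i + 1)) = cfgRow s h i := by
  obtain ⟨q, T⟩ := s
  simp only [step, Option.map_eq_none_iff] at hs
  by_cases hi : i = h
  · subst hi; simp [cfgRow, rowRule, hs]
  · by_cases h1 : i - 1 = h <;> by_cases h2 : i + 1 = h <;>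
    simp [cfgRow, rowRule, departing, hi, h1, h2, hs]

theorem cfgRow_init (x y : Γ) (n : ℕ) :
    cfgRow (init (x :: List.replicate (n + 1) y) : Cfg Γ Λ) 0 =
      seedRow (default, none) (x, some default) (y, none) n := by
  funext i
  simp only [cfgRow, seedRow, init, sub_zero]
  rcases i with (_ | i) | i
  · simp [Tape.mk₁, Tape.mk₂]
  · have : (i : ℤ) + 1 ≠ 0 := by omega
    simp only [Tape.mk₁, Tape.mk₂, Int.ofNat_eq_natCast, Tape.mk'_nth_nat, ListBlank.nth_mk]
    rw [List.getI_eq_getElem?_getD]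
    by_cases hi : i < n + 1
    · simp [this, hi]; omega
    · simp [this, hi]; omega
  · have h1 : Int.negSucc i ≠ 0 := by omega
    have h2 : ¬ 0 < Int.negSucc i := by omega
    simp only [h1, h2, if_false, false_and]
    rfl

/-- A Turing machine halts if and only if a halted cell appears in the simulating automaton. -/
theorem eval_dom_iff_rowRun (M : Machine Γ Λ) (x y : Γ) (n : ℕ) :
    (eval M (x :: List.replicate (n + 1) y)).Dom ↔
      ∃ t i, rowRun (rowRule M) (seedRow (default, none) (x, some default) (y, none) n) t i ∈
        haltedCells M := by
  rw [← cfgRow_init]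
  set s₀ : Cfg Γ Λ := init (x :: List.replicate (n + 1) y)
  have hrun : ∀ t, ∃ s h, StateTransition.Reaches (step M) s₀ s ∧
      rowRun (rowRule M) (cfgRow s₀ 0) t = cfgRow s h := by
    intro t
    induction t with
    | zero => exact ⟨s₀, 0, .refl, rfl⟩
    | succ t ih =>
      obtain ⟨s, h, hs, e⟩ := ih
      cases hst : step M s with
      | none => exact ⟨s, h, hs, funext fun i => by
          simp only [rowRun, e]; exact cfgRow_halted M hst h i⟩
      | some s' =>
        obtain ⟨h', e'⟩ := cfgRow_step M hst h
        exact ⟨s', h', hs.tail hst, funext fun i => by simp only [rowRun, e]; exact e' i⟩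
  constructor
  · intro H
    obtain ⟨s, hmem⟩ := (Part.dom_iff_mem (o := StateTransition.eval (step M) s₀)).1 H
    obtain ⟨hs, hM⟩ := StateTransition.mem_eval.1 hmem
    have : ∃ t h, rowRun (rowRule M) (cfgRow s₀ 0) t = cfgRow s h := by
      clear hM hmem
      induction hs with
      | refl => exact ⟨0, 0, rfl⟩
      | tail _ hst ih =>
        obtain ⟨t, h, e⟩ := ih
        obtain ⟨h', e'⟩ := cfgRow_step M hst h
        exact ⟨t + 1, h', funext fun i => by simp only [rowRun, e]; exact e' i⟩
    obtain ⟨t, h, e⟩ := this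
    refine ⟨t, h, ?_⟩
    rw [e]
    refine ⟨_, if_pos rfl, ?_⟩
    simpa [step, cfgRow] using hM
  · rintro ⟨t, i, q, hq, hM⟩
    obtain ⟨s, h, hs, e⟩ := hrun t
    rw [e] at hq hM
    simp only [cfgRow, Option.ite_none_right_eq_some, Option.some.injEq] at hq
    obtain ⟨rfl, rfl⟩ := hq
    exact (Part.dom_iff_mem (o := StateTransition.eval (step M) s₀)).2 ⟨s, StateTransition.mem_eval.2 ⟨hs, by
      simpa [step, cfgRow] using hM⟩⟩

end Turing.TM0

/-- There is a one-dimensional cellular automaton of radius `1` on a finite alphabet for which it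
is undecidable whether, started from a given seed row, it ever reaches a persistent set of
letters. -/
theorem exists_rowRun_undecidable :
    ∃ (A : Type) (_ : Finite A) (F : A → A → A → A) (H : Set A) (b x y : A),
      (∀ l c r, c ∈ H → F l c r ∈ H) ∧
      ¬ ComputablePred fun n => ∃ t i, rowRun F (seedRow b x y n) t i ∈ H := by
  obtain ⟨Γ, Λ, _, _, _, _, M, x, y, h⟩ := exists_finite_tm0_undecidable
  exact ⟨Γ × Option Λ, inferInstance, TM0.rowRule M, TM0.haltedCells M, _, _, _,
    fun l c r => TM0.rowRule_mem_haltedCells M l r,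
    fun H => h (H.of_eq fun n => (TM0.eval_dom_iff_rowRun M x y n).symm)⟩

end

/-! ### Rows of seed letters and the length of a seed. -/

/-- The letters of a row that shows a seed `… b b x y … y b b …`: the blanks to the left of the
seed, its first letter, its inner letters, its last letter, and the blanks to the right. -/
inductive SeedKind
  | left | start | body | last | right
  deriving DecidableEq

namespace SeedKind

instance : Fintype SeedKind :=
  ⟨{left, start, body, last, right}, by intro k; cases k <;> simp⟩

/-- `Follows k k'`: the letter `k'` may stand immediately to the right of `k`. -/
def Follows : SeedKind → SeedKind → Prop
  | left, left | left, start | start, body | start, last | body, body | body, last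
  | last, right | right, right => True
  | _, _ => False

/-- The letter at `i` of the row with the seed of length `n + 2` that starts at the origin. -/
def at' (n : ℕ) (i : ℤ) : SeedKind :=
  if i < 0 then left else if i = 0 then start else if i ≤ n then body
  else if i = n + 1 then last else right

theorem follows_at' (n : ℕ) (i : ℤ) : Follows (at' n i) (at' n (i + 1)) := by
  unfold at'
  split_ifs <;> first | trivial | omega

/-- A row of seed letters, with gaps, in which neighboring letters match, only `left` and `right`
may have a gap on their outer side, and `last` sees `start` at distance `n + 1`. -/
structure IsSeedRow (n : ℕ) (h : ℤ → Option SeedKind) : Prop where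
  succ_ne_none : ∀ i k, h i = some k → k ≠ right → h (i + 1) ≠ none
  pred_ne_none : ∀ i k, h i = some k → k ≠ left → h (i - 1) ≠ none
  follows : ∀ i k k', h i = some k → h (i + 1) = some k' → Follows k k'
  last_start : ∀ i, h i = some last → h (i - (n + 1)) = some start

end SeedKind

/-- The walk through `P` cannot pass `N`, so `Q` has to stop it. In this way finiteness of a picture
forces its seeds to be complete. -/
theorem Int.exists_walk_right {P Q : ℤ → Prop} {N : ℤ} (hP : ∀ i, P i → i ≤ N)
    (hstep : ∀ i, P i → P (i + 1) ∨ Q (i + 1)) {i : ℤ} (hi : P i) :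
    ∃ e, i < e ∧ Q e ∧ ∀ k, i ≤ k → k < e → P k := by
  by_contra! hcon
  have : ∀ m : ℕ, ∀ k, i ≤ k → k ≤ i + m → P k := by
    intro m
    induction m with
    | zero => intro k h1 h2; obtain rfl : k = i := by omega
              exact hi
    | succ m ih =>
      intro k h1 h2
      by_cases hk : k ≤ i + m
      · exact ih k h1 hk
      · obtain rfl : k = i + m + 1 := by push_cast at h2; omega
        refine (hstep _ (ih (i + m) (by omega) le_rfl)).resolve_right fun hQ => ?_
        obtain ⟨k, h3, h4, h5⟩ := hcon _ (by omega) hQ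
        exact h5 (ih k h3 (by omega))
  have := hP _ (this (N + 1 - i).toNat (i + (N + 1 - i).toNat) (by omega) le_rfl)
  omega

theorem Int.exists_walk_left {P Q : ℤ → Prop} {N : ℤ} (hP : ∀ i, P i → N ≤ i)
    (hstep : ∀ i, P i → P (i - 1) ∨ Q (i - 1)) {i : ℤ} (hi : P i) :
    ∃ e, e < i ∧ Q e ∧ ∀ k, e < k → k ≤ i → P k := by
  obtain ⟨e, h1, h2, h3⟩ := Int.exists_walk_right (P := fun i => P (-i)) (Q := fun i => Q (-i))
    (N := -N) (i := -i) (fun i h => by have := hP _ h; omega)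
    (fun i h => by simpa [neg_add, sub_eq_add_neg, add_comm] using hstep _ h) (by simpa using hi)
  refine ⟨-e, by omega, h2, fun k hk hk' => ?_⟩
  simpa using h3 (-k) (by omega) (by omega)

namespace SeedKind.IsSeedRow

variable {n : ℕ} {h : ℤ → Option SeedKind} {N : ℤ}

theorem exists_last (H : IsSeedRow n h) (hN : ∀ i, h i ≠ none → |i| ≤ N) {s : ℤ}
    (hs : h s = some start) : ∃ e, s < e ∧ h e = some last ∧ ∀ i, s < i → i < e → h i = some body := by
  have hstep : ∀ i k, h i = some k → (k = start ∨ k = body) →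
      h (i + 1) = some body ∨ h (i + 1) = some last := by
    intro i k hk hk'
    have hne := H.succ_ne_none i k hk (by rcases hk' with rfl | rfl <;> simp)
    obtain ⟨k', e⟩ := Option.ne_none_iff_exists'.1 hne
    have := H.follows i k k' hk e
    rcases hk' with rfl | rfl <;> cases k' <;> simp_all [Follows]
  rcases hstep s _ hs (Or.inl rfl) with h1 | h1
  · obtain ⟨e, h2, h3, h4⟩ := Int.exists_walk_right (P := fun i => h i = some body)
      (Q := fun i => h i = some last) (N := N)
      (fun i hi => (le_abs_self i).trans (hN i (by simp [hi])))
      (fun i hi => hstep i _ hi (Or.inr rfl)) h1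
    exact ⟨e, by omega, h3, fun i h5 h6 => h4 i (by omega) h6⟩
  · exact ⟨s + 1, by omega, h1, fun i h5 h6 => by omega⟩

/-- The letter `last` sees some `start` at distance `n + 1`, but a priori not its own. A `start`
strictly between `s` and `e` contradicts the inner letters. One to the left of `s` has its own
`last` before `s`; by induction on the position that seed has the right length, which puts its
`last` at `e`, a contradiction. -/
theorem last_eq (H : IsSeedRow n h) (hN : ∀ i, h i ≠ none → |i| ≤ N) {s e : ℤ}
    (hs : h s = some start) (hse : s < e) (he : h e = some last)
    (hb : ∀ i, s < i → i < e → h i = some body) : e = s + (n + 1) := by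
  suffices ∀ m : ℕ, ∀ s e : ℤ, (e + N).toNat ≤ m → h s = some start → s < e → h e = some last →
      (∀ i, s < i → i < e → h i = some body) → e = s + (n + 1) from
    this _ s e le_rfl hs hse he hb
  intro m
  induction m with
  | zero =>
    intro s e hm hs hse he hb
    have h1 := (neg_le_abs s).trans (hN s (by simp [hs]))
    omega
  | succ m ih =>
    intro s e hm hs hse he hb
    have hfar := H.last_start e he
    rcases lt_trichotomy s (e - (n + 1)) with h1 | h1 | h1
    · have := hb _ h1 (by omega)
      simp_all
    · omega
    · obtain ⟨e', h2, h3, h4⟩ := H.exists_last hN hfar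
      have h5 : e' < s := by
        by_contra! h5
        rcases h5.lt_or_eq with h6 | rfl
        · have := h4 s h1 h6
          simp_all
        · simp_all
      have := ih _ e' (by omega) hfar h2 h3 h4
      omega

/-- From `left` one walks to the right, from `body`, `last` and `right` to the left. No gap is met,
and in a bounded row only a `start` can end the walk. -/
theorem exists_start (H : IsSeedRow n h) (hN : ∀ i, h i ≠ none → |i| ≤ N) {i : ℤ}
    (hi : h i ≠ none) : ∃ s, h s = some start ∧ ∀ k, min i s ≤ k → k ≤ max i s → h k ≠ none := by
  have up : ∀ i, h i = some left → h (i + 1) = some left ∨ h (i + 1) = some start := by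
    intro i hk
    obtain ⟨k', e⟩ := Option.ne_none_iff_exists'.1 (H.succ_ne_none i _ hk (by simp))
    have := H.follows i _ k' hk e
    cases k' <;> simp_all [Follows]
  have down : ∀ i, (h i = some right ∨ h i = some last ∨ h i = some body) →
      (h (i - 1) = some right ∨ h (i - 1) = some last ∨ h (i - 1) = some body) ∨
        h (i - 1) = some start := by
    intro i hk
    have hne : h (i - 1) ≠ none := by
      rcases hk with hk | hk | hk <;> exact H.pred_ne_none i _ hk (by simp)
    obtain ⟨k', e⟩ := Option.ne_none_iff_exists'.1 hne
    have h1 := fun k hk => H.follows (i - 1) k' k e (by simpa using hk)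
    rcases hk with hk | hk | hk <;> have := h1 _ hk <;> cases k' <;> simp_all [Follows]
  by_cases hl : h i = some left
  · obtain ⟨e, h1, h2, h3⟩ := Int.exists_walk_right (P := fun i => h i = some left)
      (Q := fun i => h i = some start) (N := N)
      (fun i hi => (le_abs_self i).trans (hN i (by simp [hi]))) up hl
    refine ⟨e, h2, fun k hk hk' => ?_⟩
    rcases eq_or_ne k e with rfl | hke
    · simp [h2]
    · simp [h3 k (by omega) (by omega)]
  by_cases hs : h i = some start
  · refine ⟨i, hs, fun k hk hk' => ?_⟩
    obtain rfl : k = i := by omega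
    exact hi
  · have hi' : h i = some right ∨ h i = some last ∨ h i = some body := by
      obtain ⟨k, e⟩ := Option.ne_none_iff_exists'.1 hi
      cases k <;> simp_all
    obtain ⟨e, h1, h2, h3⟩ := Int.exists_walk_left
      (P := fun i => h i = some right ∨ h i = some last ∨ h i = some body)
      (Q := fun i => h i = some start) (N := -N)
      (fun i hi => by
        have := (neg_le_abs i).trans (hN i (by rcases hi with hi | hi | hi <;> simp [hi]))
        omega) down hi'
    refine ⟨e, h2, fun k hk hk' => ?_⟩
    rcases eq_or_ne k e with rfl | hke
    · simp [h2]
    · rcases h3 k (by omega) (by omega) with h | h | h <;> simp [h]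

/-- As long as there is no gap, only `left` can stand before `start` and only `right` after `last`;
the place of `last` is known from `last_eq`. -/
theorem eq_at' (H : IsSeedRow n h) (hN : ∀ i, h i ≠ none → |i| ≤ N) {s i : ℤ}
    (hs : h s = some start) (hi : ∀ k, min i s ≤ k → k ≤ max i s → h k ≠ none) :
    h i = some (at' n (i - s)) := by
  obtain ⟨e, h1, h2, h3⟩ := H.exists_last hN hs
  have he := H.last_eq hN hs h1 h2 h3
  rcases le_or_gt i s with his | his
  · suffices ∀ m : ℕ, ∀ j : ℤ, s - m = j → i ≤ j → h j = some (at' n (j - s)) from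
      this (s - i).toNat i (by omega) le_rfl
    intro m
    induction m with
    | zero => intro j hj _
              obtain rfl : j = s := by omega
              simpa [at'] using hs
    | succ m ih =>
      intro j hj hij
      have h4 := ih (j + 1) (by push_cast at hj; omega) (by omega)
      obtain ⟨k, hk⟩ := Option.ne_none_iff_exists'.1 (hi j (by omega) (by omega))
      have h5 := H.follows j _ _ hk h4
      have h6 : at' n (j - s) = left := if_pos (by push_cast at hj; omega)
      rw [h6, hk]
      unfold at' at h5
      split_ifs at h5 <;> first | omega | (cases k <;> simp_all [Follows])
  · rcases le_or_gt i e with hie | hie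
    · rcases hie.lt_or_eq with hlt | rfl
      · rw [h3 i his hlt]
        unfold at'
        split_ifs <;> first | omega | rfl
      · rw [h2]
        unfold at'
        split_ifs <;> first | omega | rfl
    · suffices ∀ m : ℕ, ∀ j : ℤ, e + 1 + m = j → j ≤ i → h j = some right by
        rw [this (i - e - 1).toNat i (by omega) le_rfl]
        unfold at'
        split_ifs <;> first | omega | rfl
      intro m
      induction m with
      | zero =>
        intro j hj hij
        obtain ⟨k, hk⟩ := Option.ne_none_iff_exists'.1 (hi j (by omega) (by omega))
        obtain rfl : e + 1 = j := by simpa using hj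
        have := H.follows e _ _ h2 hk
        cases k <;> simp_all [Follows]
      | succ m ih =>
        intro j hj hij
        have h4 := ih (j - 1) (by push_cast at hj; omega) (by omega)
        obtain ⟨k, hk⟩ := Option.ne_none_iff_exists'.1 (hi j (by omega) (by omega))
        have := H.follows (j - 1) _ k h4 (by simpa using hk)
        cases k <;> simp_all [Follows]

end SeedKind.IsSeedRow

/-! ### Finite correct pictures and halting computations. -/

/-- The letters of a picture: seed letters in the bottom row, letters of `A` above. -/
abbrev PicLetter (A : Type*) := SeedKind ⊕ A

namespace PicLetter

variable {A : Type*}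

/-- The letter of the simulated row that a letter of a picture stands for. -/
def value (b x y : A) : PicLetter A → A
  | .inl .left | .inl .right => b
  | .inl .start => x
  | .inl .body | .inl .last => y
  | .inr a => a

/-- The constraint on the letter `c` at the origin of `p`, given the letter `far` at a distance to
the left: a letter of `A` is computed from the three letters below it, a seed letter matches its
horizontal neighbors, and there is a letter above unless `c` is in the target set. -/
def Correct (F : A → A → A → A) (H : Set A) (b x y : A) (p : ℤ → ℤ → Option (PicLetter A))
    (far : Option (PicLetter A)) (c : PicLetter A) : Prop :=
  (value b x y c ∈ H ∨ p (-1) 1 ≠ none ∨ p 0 1 ≠ none ∨ p 1 1 ≠ none) ∧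
  (∀ k, c = .inl k →
    (k ≠ .right → p 1 0 ≠ none) ∧ (k ≠ .left → p (-1) 0 ≠ none) ∧
    (∀ d, p 1 0 = some d → ∃ k', d = .inl k' ∧ k.Follows k') ∧
    (∀ d, p (-1) 0 = some d → ∃ k', d = .inl k' ∧ k'.Follows k) ∧
    (k = .last → far = some (.inl .start))) ∧
  (∀ a, c = .inr a → ∃ l m r, p (-1) (-1) = some l ∧ p 0 (-1) = some m ∧ p 1 (-1) = some r ∧
    a = F (value b x y l) (value b x y m) (value b x y r))

theorem Correct.congr {F : A → A → A → A} {H : Set A} {b x y : A}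
    {p p' : ℤ → ℤ → Option (PicLetter A)} {far : Option (PicLetter A)} {c : PicLetter A}
    (hp : ∀ i j, |i| ≤ 1 → |j| ≤ 1 → p i j = p' i j) :
    Correct F H b x y p far c ↔ Correct F H b x y p' far c := by
  unfold Correct
  rw [hp (-1) 1 (by simp) (by simp), hp 0 1 (by simp) (by simp), hp 1 1 (by simp) (by simp),
    hp 1 0 (by simp) (by simp), hp (-1) 0 (by simp) (by simp), hp (-1) (-1) (by simp) (by simp),
    hp 0 (-1) (by simp) (by simp), hp 1 (-1) (by simp) (by simp)]

end PicLetter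

/-- A finite nonempty picture each of whose letters satisfies the constraint, where the seed has
length `n + 2`. -/
structure IsCorrectPicture {A : Type*} (F : A → A → A → A) (H : Set A) (b x y : A) (n : ℕ)
    (r : ℤ → ℤ → Option (PicLetter A)) : Prop where
  finite : {v : ℤ × ℤ | r v.1 v.2 ≠ none}.Finite
  nonempty : ∃ i j, r i j ≠ none
  correct : ∀ i j c, r i j = some c →
    PicLetter.Correct F H b x y (fun a d => r (i + a) (j + d)) (r (i - (n + 1)) j) c

open PicLetter

theorem value_at' {A : Type*} (b x y : A) (n : ℕ) (i : ℤ) :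
    value b x y (.inl (SeedKind.at' n i)) = seedRow b x y n i := by
  unfold SeedKind.at' seedRow
  split_ifs <;> first | rfl | omega

theorem rowRun_mem_of_le {A : Type*} {F : A → A → A → A} {H : Set A}
    (hH : ∀ l c r, c ∈ H → F l c r ∈ H) {c : ℤ → A} {t T : ℕ} {i : ℤ} (h : rowRun F c t i ∈ H)
    (hT : t ≤ T) : rowRun F c T i ∈ H := by
  induction hT with
  | refl => exact h
  | step _ ih => exact hH _ _ _ ih

/-- The picture is a triangle cut out of the space-time diagram, with its apex at a letter of `H`
and its base in the seed row; every cell except the apex has an occupied cell above it. -/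
theorem exists_isCorrectPicture {A : Type*} {F : A → A → A → A} {H : Set A}
    (hH : ∀ l c r, c ∈ H → F l c r ∈ H) {b x y : A} {n t : ℕ} {i₀ : ℤ}
    (h : rowRun F (seedRow b x y n) t i₀ ∈ H) :
    ∃ r, IsCorrectPicture F H b x y n r := by
  classical
  -- Persistence of `H` allows the apex to be raised from `t` to `T`. The other terms make the base
  -- reach beyond the seed on both sides, so that its outer letters are `left` and `right`, which
  -- may border a gap.
  set T : ℕ := t + i₀.natAbs + n + 3 with hT
  have hmem : rowRun F (seedRow b x y n) T i₀ ∈ H := rowRun_mem_of_le hH h (by omega)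
  let val : ℤ → ℤ → PicLetter A := fun i j =>
    if j = 0 then .inl (SeedKind.at' n i) else .inr (rowRun F (seedRow b x y n) j.toNat i)
  have hval : ∀ i j, 0 ≤ j → value b x y (val i j) = rowRun F (seedRow b x y n) j.toNat i := by
    intro i j hj
    by_cases h0 : j = 0
    · subst h0; simp only [val, if_true, value_at']; rfl
    · simp only [val, h0, if_false]; rfl
  let D : ℤ → ℤ → Prop := fun i j => 0 ≤ j ∧ |i - i₀| ≤ T - j
  let r : ℤ → ℤ → Option (PicLetter A) := fun i j => if D i j then some (val i j) else none
  have hr : ∀ i j, D i j → r i j = some (val i j) := fun i j h => if_pos h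
  have hr' : ∀ i j, D i j → r i j ≠ none := fun i j h => by simp [hr i j h]
  have hD : ∀ i j, D i j ↔ 0 ≤ j ∧ i - i₀ ≤ T - j ∧ i₀ - i ≤ T - j := by
    intro i j; simp only [D, abs_le]; omega
  refine ⟨r, ?_, ⟨i₀, 0, hr' _ _ ((hD _ _).2 (by omega))⟩, fun i j c hc => ?_⟩
  · refine (Set.finite_Icc ((i₀ - T, 0) : ℤ × ℤ) (i₀ + T, T)).subset fun v hv => ?_
    have hv : D v.1 v.2 := by
      by_contra hD
      exact hv (if_neg hD)
    rw [hD] at hv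
    exact ⟨⟨by simp only; omega, hv.1⟩, ⟨by simp only; omega, by simp only; omega⟩⟩
  · have hDij : D i j := by
      by_contra hD
      simp [r, hD] at hc
    have hcv : val i j = c := by simpa [r, hDij] using hc
    rw [hD] at hDij
    subst hcv
    refine ⟨?_, fun k hk => ?_, fun a ha => ?_⟩
    · rw [hval _ _ hDij.1]
      by_cases hjT : j = T
      · obtain rfl : i = i₀ := by omega
        left; rw [hjT]; exact hmem
      · right
        rcases lt_trichotomy i i₀ with hi | hi | hi
        · exact Or.inr (Or.inr (hr' _ _ ((hD _ _).2 (by omega))))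
        · exact Or.inr (Or.inl (hr' _ _ ((hD _ _).2 (by omega))))
        · exact Or.inl (hr' _ _ ((hD _ _).2 (by omega)))
    · obtain rfl : j = 0 := by
        by_contra h0
        simp [val, h0] at hk
      obtain rfl : SeedKind.at' n i = k := by simpa [val] using hk
      have hval0 : ∀ i, val i 0 = .inl (SeedKind.at' n i) := fun i => if_pos rfl
      refine ⟨fun hne => hr' _ _ ((hD _ _).2 ?_), fun hne => hr' _ _ ((hD _ _).2 ?_),
        fun d hd => ?_, fun d hd => ?_, fun hlast => ?_⟩
      · have : i ≤ n + 1 := by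
          by_contra! h1
          apply hne; unfold SeedKind.at'
          split_ifs <;> first | rfl | omega
        omega
      · have : 0 ≤ i := by
          by_contra! h1
          exact hne (if_pos h1)
        omega
      · refine ⟨SeedKind.at' n (i + 1), ?_, SeedKind.follows_at' n i⟩
        simp only [r, add_zero, hval0] at hd
        split_ifs at hd
        exact (Option.some.inj hd).symm
      · refine ⟨SeedKind.at' n (i - 1), ?_, by simpa using SeedKind.follows_at' n (i - 1)⟩
        simp only [r, add_zero, hval0] at hd
        split_ifs at hd
        exact (Option.some.inj hd).symm
      · obtain rfl : i = n + 1 := by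
          unfold SeedKind.at' at hlast
          split_ifs at hlast; assumption
        rw [sub_self, hr _ _ ((hD _ _).2 (by omega)), hval0]
        rfl
    · have h0 : j ≠ 0 := by
        rintro rfl
        simp [val] at ha
      have hbelow : ∀ a, |a| ≤ 1 → r (i + a) (j + -1) = some (val (i + a) (j + -1)) := by
        intro a ha
        rw [abs_le] at ha
        exact hr _ _ ((hD _ _).2 (by omega))
      refine ⟨_, _, _, hbelow _ (by simp), hbelow _ (by simp), hbelow _ (by simp), ?_⟩
      rw [hval _ _ (by omega), hval _ _ (by omega), hval _ _ (by omega)]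
      have : rowRun F (seedRow b x y n) j.toNat i = a := by simpa [val, h0] using ha
      rw [← this, show j.toNat = (j + -1).toNat + 1 by omega]
      simp only [rowRun, add_zero, sub_eq_add_neg]

theorem IsCorrectPicture.seed {A : Type*} {F : A → A → A → A} {H : Set A} {b x y : A} {n : ℕ}
    {r : ℤ → ℤ → Option (PicLetter A)} (hr : IsCorrectPicture F H b x y n r) {i j : ℤ}
    {k : SeedKind} (h : r i j = some (.inl k)) :
    (k ≠ .right → r (i + 1) j ≠ none) ∧ (k ≠ .left → r (i - 1) j ≠ none) ∧
    (∀ d, r (i + 1) j = some d → ∃ k', d = .inl k' ∧ k.Follows k') ∧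
    (∀ d, r (i - 1) j = some d → ∃ k', d = .inl k' ∧ k'.Follows k) ∧
    (k = .last → r (i - (n + 1)) j = some (.inl .start)) := by
  have := (hr.correct i j _ h).2.1 k rfl
  simp only [add_zero] at this
  exact this

theorem IsCorrectPicture.below {A : Type*} {F : A → A → A → A} {H : Set A} {b x y : A} {n : ℕ}
    {r : ℤ → ℤ → Option (PicLetter A)} (hr : IsCorrectPicture F H b x y n r) {i j : ℤ}
    {a : A} (h : r i j = some (.inr a)) :
    ∃ l m r', r (i - 1) (j - 1) = some l ∧ r i (j - 1) = some m ∧ r (i + 1) (j - 1) = some r' ∧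
      a = F (value b x y l) (value b x y m) (value b x y r') := by
  have := (hr.correct i j _ h).2.2 a rfl
  simp only [add_zero] at this
  exact this

/-- A letter in the highest row has value in `H`, having nothing above it. Below it a full triangle
is occupied down to the first seed letter, which exists because the picture is finite. Horizontal
matching turns that level of the triangle into seed letters, which belong to one seed placed at some
`s`. Computing upwards then shows that the value at the apex is an entry of `rowRun`. -/
theorem IsCorrectPicture.exists_mem {A : Type*} {F : A → A → A → A} {H : Set A} {b x y : A} {n : ℕ}
    {r : ℤ → ℤ → Option (PicLetter A)} (hr : IsCorrectPicture F H b x y n r) :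
    ∃ t i, rowRun F (seedRow b x y n) t i ∈ H := by
  classical
  obtain ⟨N, hN⟩ : ∃ N : ℤ, ∀ i j, r i j ≠ none → |i| ≤ N ∧ |j| ≤ N := by
    obtain ⟨M, hM⟩ := (hr.finite.image fun v => max |v.1| |v.2|).bddAbove
    refine ⟨M, fun i j h => ?_⟩
    have : max |i| |j| ≤ M := hM ⟨(i, j), h, rfl⟩
    exact ⟨(le_max_left _ _).trans this, (le_max_right _ _).trans this⟩
  obtain ⟨⟨I, J⟩, hIJ, hmax⟩ := hr.finite.exists_maximalFor (fun v => v.2) _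
    (let ⟨i, j, h⟩ := hr.nonempty; ⟨(i, j), h⟩)
  have htop : ∀ i j, J < j → r i j = none := by
    intro i j hj
    by_contra h
    have := hmax (j := (i, j)) h hj.le
    simp only at this; omega
  have hI : ∃ c, r I J = some c ∧ value b x y c ∈ H := by
    obtain ⟨c, hc⟩ := Option.ne_none_iff_exists'.1 hIJ
    refine ⟨c, hc, ?_⟩
    simpa [htop] using (hr.correct I J c hc).1
  have htri : ∀ t : ℕ, (∀ s < t, ∀ i, |i - I| ≤ s → ∀ k, r i (J - s) ≠ some (.inl k)) →
      ∀ i, |i - I| ≤ t → r i (J - t) ≠ none := by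
    intro t
    induction t with
    | zero =>
      intro _ i hi
      obtain rfl : i = I := by simpa [sub_eq_zero] using hi
      simpa using hIJ
    | succ t ih =>
      intro hno i hi
      have h1 := ih fun s hs => hno s (by omega)
      have h2 : ∀ i, |i - I| ≤ t → ∀ d, |d| ≤ 1 → r (i + d) (J - (t + 1)) ≠ none := by
        intro i hi d hd
        obtain ⟨c, hc⟩ := Option.ne_none_iff_exists'.1 (h1 i hi)
        rcases c with k | a
        · exact absurd hc (hno t (by omega) i hi k)
        · obtain ⟨l, m, r', e1, e2, e3, -⟩ := hr.below hc
          rw [show J - (t + 1 : ℤ) = J - t - 1 by ring]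
          rw [abs_le] at hd
          obtain rfl | rfl | rfl : d = -1 ∨ d = 0 ∨ d = 1 := by omega
          · simp [← sub_eq_add_neg, e1]
          · simp [e2]
          · simp [e3]
      push_cast at hi ⊢
      rw [abs_le] at hi
      rcases lt_trichotomy i I with h | h | h
      · have := h2 (i + 1) (abs_le.2 (by omega)) (-1) (by simp)
        rwa [show i + 1 + -1 = i by ring] at this
      · have := h2 i (abs_le.2 (by omega)) 0 (by simp)
        rwa [add_zero] at this
      · have := h2 (i - 1) (abs_le.2 (by omega)) 1 (by simp)
        rwa [sub_add_cancel] at this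
  have hex : ∃ t : ℕ, ∃ i k, |i - I| ≤ t ∧ r i (J - t) = some (.inl k) := by
    by_contra! hcon
    have h1 := htri (J + N + 1).toNat (fun s _ i hi k => hcon s i k hi) I (by simp)
    have h2 := (hN _ _ h1).2
    have h3 := (hN _ _ hIJ).2
    rw [abs_le] at h2 h3
    omega
  -- The least depth is taken, so the levels above it in the triangle contain only letters of `A`.
  obtain ⟨i₁, k₁, hi₁, hk₁⟩ := Nat.find_spec hex
  have hmin := fun s hs => Nat.find_min (m := s) hex hs
  set t := Nat.find hex
  have hne := htri t fun s hs i hi k hk => hmin s hs ⟨i, k, hi, hk⟩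
  -- Letters of `A` in this row count as gaps.
  set g : ℤ → Option SeedKind := fun i => (r i (J - t)).bind fun c => c.elim some fun _ => none
    with hg
  have hgs : ∀ i k, g i = some k ↔ r i (J - t) = some (.inl k) := by
    intro i k
    simp only [hg]
    rcases r i (J - t) with _ | (k' | a) <;> simp
  have hrow : SeedKind.IsSeedRow n g := by
    constructor
    · intro i k hk hkr
      obtain ⟨h1, -, h2, -, -⟩ := hr.seed ((hgs i k).1 hk)
      obtain ⟨d, hd⟩ := Option.ne_none_iff_exists'.1 (h1 hkr)
      obtain ⟨k', rfl, -⟩ := h2 d hd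
      simp [(hgs _ _).2 hd]
    · intro i k hk hkr
      obtain ⟨-, h1, -, h2, -⟩ := hr.seed ((hgs i k).1 hk)
      obtain ⟨d, hd⟩ := Option.ne_none_iff_exists'.1 (h1 hkr)
      obtain ⟨k', rfl, -⟩ := h2 d hd
      simp [(hgs _ _).2 hd]
    · intro i k k' hk hk'
      obtain ⟨-, -, h2, -, -⟩ := hr.seed ((hgs i k).1 hk)
      obtain ⟨k'', e, h3⟩ := h2 (.inl k') ((hgs _ _).1 hk')
      obtain rfl : k' = k'' := by simpa using e
      exact h3
    · intro i hk
      obtain ⟨-, -, -, -, h2⟩ := hr.seed ((hgs i _).1 hk)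
      exact (hgs _ _).2 (h2 rfl)
  have hgN : ∀ i, g i ≠ none → |i| ≤ N := by
    intro i hi
    obtain ⟨k, hk⟩ := Option.ne_none_iff_exists'.1 hi
    exact (hN i (J - t) (by simp [(hgs i k).1 hk])).1
  have hseed : ∀ i, |i - I| ≤ t → g i ≠ none := by
    rw [abs_le] at hi₁
    have hup : ∀ m : ℕ, i₁ + m - I ≤ t → g (i₁ + m) ≠ none := by
      intro m
      induction m with
      | zero => intro _; simp [(hgs i₁ k₁).2 hk₁]
      | succ m ih =>
        intro hm
        push_cast at hm ⊢
        obtain ⟨k, hk⟩ := Option.ne_none_iff_exists'.1 (ih (by omega))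
        obtain ⟨-, -, h2, -, -⟩ := hr.seed ((hgs _ k).1 hk)
        obtain ⟨d, hd⟩ := Option.ne_none_iff_exists'.1
          (hne (i₁ + m + 1) (abs_le.2 (by omega)))
        obtain ⟨k', rfl, -⟩ := h2 d hd
        rw [← add_assoc]
        simp [(hgs _ _).2 hd]
    have hdown : ∀ m : ℕ, -(t : ℤ) ≤ i₁ - m - I → g (i₁ - m) ≠ none := by
      intro m
      induction m with
      | zero => intro _; simp [(hgs i₁ k₁).2 hk₁]
      | succ m ih =>
        intro hm
        push_cast at hm ⊢
        obtain ⟨k, hk⟩ := Option.ne_none_iff_exists'.1 (ih (by omega))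
        obtain ⟨-, -, -, h2, -⟩ := hr.seed ((hgs _ k).1 hk)
        obtain ⟨d, hd⟩ := Option.ne_none_iff_exists'.1
          (hne (i₁ - m - 1) (abs_le.2 (by omega)))
        obtain ⟨k', rfl, -⟩ := h2 d hd
        rw [show i₁ - (m + 1 : ℤ) = i₁ - m - 1 by ring]
        simp [(hgs _ _).2 hd]
    intro i hi
    rw [abs_le] at hi
    rcases le_total i₁ i with h | h
    · have := hup (i - i₁).toNat (by omega)
      rwa [show i₁ + ((i - i₁).toNat : ℤ) = i by omega] at this
    · have := hdown (i₁ - i).toNat (by omega)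
      rwa [show i₁ - ((i₁ - i).toNat : ℤ) = i by omega] at this
  obtain ⟨s, hs, hconn⟩ := hrow.exists_start hgN (hseed I (by simp))
  have hbase : ∀ i, |i - I| ≤ t → g i = some (SeedKind.at' n (i - s)) := by
    intro i hi
    -- The `start` at `s` may lie outside the base of the triangle; `hconn` rules out gaps on the
    -- way to it.
    refine hrow.eq_at' hgN hs fun k h1 h2 => ?_
    by_cases hk : |k - I| ≤ t
    · exact hseed k hk
    · rw [abs_le] at hk hi
      exact hconn k (by omega) (by omega)
  have hrun : ∀ m : ℕ, m ≤ t → ∀ i, |i - I| ≤ t - m → ∃ c, r i (J - t + m) = some c ∧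
      value b x y c = rowRun F (seedRow b x y n) m (i - s) := by
    intro m
    induction m with
    | zero =>
      intro _ i hi
      refine ⟨_, by simpa using (hgs _ _).1 (hbase i (by simpa using hi)), value_at' _ _ _ _ _⟩
    | succ m ih =>
      intro hm i hi
      have e : J - (t : ℤ) + (m + 1 : ℕ) = J - (t - (m + 1) : ℕ) := by omega
      rw [e]
      obtain ⟨c, hc⟩ := Option.ne_none_iff_exists'.1 (htri (t - (m + 1))
        (fun s hs i hi k hk => hmin s (by omega) ⟨i, k, hi, hk⟩) i (by omega))
      refine ⟨c, hc, ?_⟩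
      rcases c with k | a
      · exact absurd ⟨i, k, by omega, hc⟩ (hmin (t - (m + 1)) (by omega))
      · obtain ⟨l, m', r', e1, e2, e3, rfl⟩ := hr.below hc
        rw [← e, show J - (t : ℤ) + (m + 1 : ℕ) - 1 = J - t + m by push_cast; ring] at e1 e2 e3
        push_cast at hi
        rw [abs_le] at hi
        obtain ⟨c1, h1, h1'⟩ := ih (by omega) (i - 1) (abs_le.2 (by omega))
        obtain ⟨c2, h2, h2'⟩ := ih (by omega) i (abs_le.2 (by omega))
        obtain ⟨c3, h3, h3'⟩ := ih (by omega) (i + 1) (abs_le.2 (by omega))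
        obtain rfl : c1 = l := by simpa [h1] using e1
        obtain rfl : c2 = m' := by simpa [h2] using e2
        obtain rfl : c3 = r' := by simpa [h3] using e3
        change F _ _ _ = F _ _ _
        rw [h1', h2', h3', show i - 1 - s = i - s - 1 by ring,
          show i + 1 - s = i - s + 1 by ring]
  obtain ⟨c, hc, hc'⟩ := hrun t le_rfl I (by simp)
  obtain ⟨c', hc1, hc2⟩ := hI
  obtain rfl : c' = c := by simpa [hc1] using hc
  exact ⟨t, I - s, hc' ▸ hc2⟩

/-! ### Letters as runs of zeros: pictures as fixed points. -/

/-- A local rule that reads two windows is given by a list of words, whatever the displacement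
of the second window. -/
theorem exists_words_of_local (L₀ L₁ : List (ℤ × ℤ)) (out : Config → Config → Prop)
    (hout : ∀ x x' y y', (∀ u ∈ L₀, x u = x' u) → (∀ u ∈ L₁, y u = y' u) → out x y → out x' y') :
    ∃ T : List (List Bool), ∀ (d : ℤ × ℤ → ℤ × ℤ) (x : Config) (v : ℤ × ℤ),
      (CACode.toCA (L₀ ++ L₁.map d, T)).step x v = true ↔
        out (fun u => x (v + u)) (fun u => x (v + d u)) := by
  -- The table collects the words of all accepted pairs of windows; a displacement moves the cells
  -- that are read and leaves the words alone.
  have hfin : {w : List Bool | ∃ x y, w = L₀.map x ++ L₁.map y ∧ out x y}.Finite := by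
    refine (List.finite_length_eq Bool (L₀.length + L₁.length)).subset ?_
    rintro _ ⟨x, y, rfl, -⟩
    simp
  refine ⟨hfin.toFinset.toList, fun d x v => ?_⟩
  have hword : ∀ L : List (ℤ × ℤ), (L.attach.map fun n => x (v + n.1)) = L.map fun u => x (v + u) :=
    fun L => List.attach_map_val (f := fun u => x (v + u))
  simp only [CellularAutomaton.step, CACode.toCA, decide_eq_true_eq]
  rw [hword, Finset.mem_toList, Set.Finite.mem_toFinset, List.map_append, List.map_map]
  constructor
  · rintro ⟨x', y', h, ho⟩
    obtain ⟨h1, h2⟩ := List.append_inj h (by simp)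
    exact hout _ _ _ _ (fun u hu => (List.map_inj_left.1 h1 u hu).symm)
      (fun u hu => (List.map_inj_left.1 h2 u hu).symm) ho
  · intro ho
    exact ⟨_, _, rfl, ho⟩

namespace RunCode

variable {B : Type*} (e : B → ℕ)

/-- The cell `(a, b)` is the left end of a maximal horizontal run of zeros whose length encodes
the letter `c`. -/
def IsLetter (x : Config) (a b : ℤ) (c : B) : Prop :=
  x (a - 1, b) = true ∧ (∀ s : ℕ, s ≤ e c → x (a + s, b) = false) ∧ x (a + e c + 1, b) = true

open Classical in
/-- The letter encoded by the run of zeros that starts at `(a, b)`. -/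
noncomputable def letterAt (x : Config) (a b : ℤ) : Option B :=
  if h : ∃ c, IsLetter e x a b c then some h.choose else none

variable {e}

theorem IsLetter.unique (he : Function.Injective e) {x : Config} {a b : ℤ} {c c' : B}
    (h : IsLetter e x a b c) (h' : IsLetter e x a b c') : c = c' := by
  apply he
  by_contra hne
  rcases lt_or_gt_of_ne hne with hlt | hlt
  · have h1 := h.2.2
    have h2 := h'.2.1 (e c + 1) hlt
    push_cast at h2
    rw [← add_assoc] at h2
    simp_all
  · have h1 := h'.2.2
    have h2 := h.2.1 (e c' + 1) hlt
    push_cast at h2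
    rw [← add_assoc] at h2
    simp_all

theorem letterAt_eq_some (he : Function.Injective e) {x : Config} {a b : ℤ} {c : B} :
    letterAt e x a b = some c ↔ IsLetter e x a b c := by
  unfold letterAt
  split_ifs with h
  · rw [Option.some.injEq]
    exact ⟨fun hc => hc ▸ h.choose_spec, fun hc => h.choose_spec.unique he hc⟩
  · exact ⟨fun hc => by simp at hc, fun hc => absurd ⟨c, hc⟩ h⟩

/-- A run has at most `m` zeros, so together with its two delimiting ones it fits into the window
from `-1` to `m`. -/
theorem letterAt_congr {x x' : Config} {a b a' b' : ℤ} {m : ℕ} (hm : ∀ c, e c < m)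
    (h : ∀ s : ℤ, -1 ≤ s → s ≤ m → x (a + s, b) = x' (a' + s, b')) :
    letterAt e x a b = letterAt e x' a' b' := by
  have : ∀ c, IsLetter e x a b c ↔ IsLetter e x' a' b' c := by
    intro c
    have hc := hm c
    unfold IsLetter
    rw [sub_eq_add_neg, sub_eq_add_neg, h (-1) le_rfl (by omega), add_assoc a, add_assoc a',
      h (e c + 1) (by omega) (by omega)]
    refine and_congr_right fun _ => and_congr_left fun _ => forall₂_congr fun s hs => ?_
    rw [h s (by omega) (by omega)]
  have this : IsLetter e x a b = IsLetter e x' a' b' := funext fun c => propext (this c)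
  unfold letterAt
  rw [this]

variable (e) in
/-- The condition under which a cell gets the state `1` in the freezing automaton that erases the
runs of zeros that violate the constraint `C`. -/
def Erased (C : (ℤ → ℤ → Option B) → Option B → B → Prop) (m : ℕ) (x y : Config) : Prop :=
  x (0, 0) = true ∨ (x (-1, 0) = true ∧ ∀ c, IsLetter e x 0 0 c →
    ¬ C (fun i j => letterAt e x (i * (m + 1)) j) (letterAt e y 0 0) c)

/-- The lists and the table are chosen before `n`, which makes the sequence of codes visibly
computable. The bound on `L₁` keeps the displaced offsets negative. -/
theorem exists_words (he : Function.Injective e) {m : ℕ} (hm : ∀ c, e c < m)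
    (C : (ℤ → ℤ → Option B) → Option B → B → Prop)
    (hC : ∀ p p' far c, (∀ i j, |i| ≤ 1 → |j| ≤ 1 → p i j = p' i j) → (C p far c ↔ C p' far c)) :
    ∃ (L₀ : List (ℤ × ℤ)) (L₁ : List ℤ) (T : List (List Bool)), (∀ s ∈ L₁, s < m + 1) ∧
      ∀ (n : ℕ) (x : Config) (v : ℤ × ℤ),
      (CACode.toCA (L₀ ++ L₁.map fun s => (s - ((n : ℤ) + 1) * (m + 1), (0 : ℤ)), T)).step x v = true ↔
        Erased e C m (fun u => x (v + u)) (fun u => x (v + (u.1 - (n + 1) * (m + 1), u.2))) := by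
  -- The cells to be read have abscissa `i * (m + 1) + s` with `|i| ≤ 1` and `-1 ≤ s ≤ m`.
  let R : ℤ := 2 * m + 2
  obtain ⟨T, hT⟩ := exists_words_of_local (Finset.Icc (-R, -R) (R, R)).toList
    ((Finset.Icc (-1 : ℤ) m).toList.map fun s => (s, 0)) (Erased e C m) (by
      intro x x' y y' hx hy h
      have hx' : ∀ a b : ℤ, |a| ≤ R → |b| ≤ R → x (a, b) = x' (a, b) := by
        intro a b ha hb
        rw [abs_le] at ha hb
        exact hx _ (Finset.mem_toList.2 (Finset.mem_Icc.2 ⟨⟨ha.1, hb.1⟩, ha.2, hb.2⟩))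
      have h0 : letterAt e x 0 0 = letterAt e x' 0 0 :=
        letterAt_congr hm fun s h1 h2 => hx' _ _ (by rw [abs_le]; omega) (by simp; omega)
      have h1 : letterAt e y 0 0 = letterAt e y' 0 0 :=
        letterAt_congr hm fun s h1 h2 => hy _ (by simp; omega)
      unfold Erased at h ⊢
      rw [← hx' 0 0 (by simp; omega) (by simp; omega),
        ← hx' (-1) 0 (by simp; omega) (by simp; omega)]
      refine h.imp_right fun h => ⟨h.1, fun c hc hcon => h.2 c ?_ ?_⟩
      · rwa [← letterAt_eq_some he, h0, letterAt_eq_some he]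
      · rw [h1]
        refine (hC _ _ _ _ fun i j hi hj => ?_).1 hcon
        refine (letterAt_congr hm fun s h1 h2 => hx' _ _ ?_ ?_).symm
        · rw [abs_le] at hi ⊢
          obtain rfl | rfl | rfl : i = -1 ∨ i = 0 ∨ i = 1 := by omega
          all_goals omega
        · exact hj.trans (by omega))
  refine ⟨(Finset.Icc (-R, -R) (R, R)).toList, (Finset.Icc (-1 : ℤ) m).toList, T, fun s hs => ?_, fun n x v => ?_⟩
  · rw [Finset.mem_toList, Finset.mem_Icc] at hs
    omega
  · have := hT (fun u => (u.1 - (n + 1) * (m + 1), u.2)) x v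
    rw [List.map_map] at this
    exact this

/-- In a fixed point nothing is erased, so every zero with a one on its left starts a letter that
satisfies `C`. The picture is read on a grid of horizontal period `m + 1`; runs off the grid are
ignored, as the constraint at a grid cell concerns grid cells only. -/
theorem exists_picture_of_fixedPoint (he : Function.Injective e) {m : ℕ} (hm : ∀ c, e c < m)
    {C : (ℤ → ℤ → Option B) → Option B → B → Prop} {n : ℕ} {f : CellularAutomaton}
    (hf : ∀ x v, f.step x v = true ↔
      Erased e C m (fun u => x (v + u)) (fun u => x (v + (u.1 - (n + 1) * (m + 1), u.2))))
    {x : Config} (hx : f.step x = x) (hfin : {v | x v = false}.Finite)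
    (hne : {v | x v = false}.Nonempty) :
    ∃ r : ℤ → ℤ → Option B, {v : ℤ × ℤ | r v.1 v.2 ≠ none}.Finite ∧ (∃ i j, r i j ≠ none) ∧
      ∀ i j c, r i j = some c → C (fun a d => r (i + a) (j + d)) (r (i - (n + 1)) j) c := by
  have key : ∀ a b, x (a, b) = false → x (a - 1, b) = true → ∃ c, IsLetter e x a b c ∧
      C (fun i j => letterAt e x (a + i * (m + 1)) (b + j))
        (letterAt e x (a - (n + 1) * (m + 1)) b) c := by
    intro a b h0 h1
    have h2 : ¬ Erased e C m _ _ := mt (hf x (a, b)).2 (by rw [hx, h0]; simp)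
    unfold Erased at h2
    push Not at h2
    obtain ⟨c, hc, hC⟩ := h2.2 (by simpa [sub_eq_add_neg] using h1)
    refine ⟨c, ?_, ?_⟩
    · rw [← letterAt_eq_some he] at hc ⊢
      rw [← hc]
      exact letterAt_congr hm fun s _ _ => by simp
    · convert hC using 1
      · funext i j
        exact letterAt_congr hm fun s _ _ => by simp [add_assoc]
      · refine letterAt_congr hm fun s _ _ => ?_
        simp only [Prod.mk_add_mk, add_zero, zero_add]
        congr 2; ring
  -- A leftmost zero has a one on its left; anchoring the grid there makes the picture nonempty.
  obtain ⟨⟨a₀, b₀⟩, h₀, hmin⟩ := hfin.exists_minimalFor (fun v => v.1) _ hne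
  have h₁ : x (a₀ - 1, b₀) = true := by
    by_contra hcon
    have := hmin (j := (a₀ - 1, b₀)) (by simpa using hcon) (by simp)
    simp at this
  refine ⟨fun i j => letterAt e x (a₀ + i * (m + 1)) (b₀ + j), ?_, ⟨0, 0, ?_⟩, fun i j c hc => ?_⟩
  · refine Set.Finite.subset (hfin.preimage
      (f := fun v : ℤ × ℤ => (a₀ + v.1 * (m + 1), b₀ + v.2)) ?_) fun v hv => ?_
    · rintro ⟨i, j⟩ - ⟨i', j'⟩ - h
      simp only [Prod.mk.injEq, add_right_inj] at h
      have : (m : ℤ) + 1 ≠ 0 := by omega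
      exact Prod.ext (mul_right_cancel₀ this h.1) h.2
    · obtain ⟨c, hc⟩ := Option.ne_none_iff_exists'.1 hv
      rw [letterAt_eq_some he] at hc
      simpa using hc.2.1 0 (by simp)
  · obtain ⟨c, hc, -⟩ := key a₀ b₀ h₀ h₁
    rw [← letterAt_eq_some he] at hc
    simp [hc]
  · rw [letterAt_eq_some he] at hc
    obtain ⟨c', hc', hC⟩ := key _ _ (by simpa using hc.2.1 0 (by simp)) hc.1
    obtain rfl := hc.unique he hc'
    convert hC using 1
    · funext i' j'
      beta_reduce
      rw [add_mul, add_assoc, add_assoc]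
    · beta_reduce
      congr 1; ring

/-- Each letter becomes a run at the left end of a block of `m + 1` cells. As `e c < m`, the last
cell of a block is a one, so runs do not merge, and the zeros with a one on their left are exactly
the first cells of the occupied blocks. -/
theorem exists_fixedPoint_of_picture (he : Function.Injective e) {m : ℕ} (hm : ∀ c, e c < m)
    {C : (ℤ → ℤ → Option B) → Option B → B → Prop} {n : ℕ} {f : CellularAutomaton}
    (hf : ∀ x v, f.step x v = true ↔
      Erased e C m (fun u => x (v + u)) (fun u => x (v + (u.1 - (n + 1) * (m + 1), u.2))))
    {r : ℤ → ℤ → Option B} (hfin : {v : ℤ × ℤ | r v.1 v.2 ≠ none}.Finite)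
    (hne : ∃ i j, r i j ≠ none)
    (hr : ∀ i j c, r i j = some c → C (fun a d => r (i + a) (j + d)) (r (i - (n + 1)) j) c) :
    ∃ x, f.step x = x ∧ {v | x v = false}.Finite ∧ {v | x v = false}.Nonempty := by
  classical
  have hW : (0 : ℤ) < m + 1 := by omega
  let x : Config := fun v =>
    !decide (∃ c, r (v.1 / (m + 1)) v.2 = some c ∧ v.1 % (m + 1) ≤ e c)
  have hx : ∀ i s j : ℤ, 0 ≤ s → s ≤ m →
      (x (i * (m + 1) + s, j) = false ↔ ∃ c, r i j = some c ∧ s ≤ e c) := by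
    intro i s j h0 hs
    have h1 : (i * (m + 1) + s) / ((m : ℤ) + 1) = i := by
      rw [add_comm, Int.add_mul_ediv_right _ _ hW.ne', Int.ediv_eq_zero_of_lt h0 (by omega), zero_add]
    have h2 : (i * (m + 1) + s) % ((m : ℤ) + 1) = s := by
      rw [add_comm, Int.add_mul_emod_self_right, Int.emod_eq_of_lt h0 (by omega)]
    simp [x, h1, h2]
  have hdecomp : ∀ a : ℤ, ∃ i s : ℤ, 0 ≤ s ∧ s ≤ m ∧ a = i * (m + 1) + s := fun a =>
    ⟨a / (m + 1), a % (m + 1), Int.emod_nonneg _ hW.ne', by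
      have := Int.emod_lt_of_pos a hW; omega, (Int.ediv_mul_add_emod a (m + 1)).symm⟩
  have hlast : ∀ i j : ℤ, x (i * (m + 1) - 1, j) = true := by
    intro i j
    rw [show i * ((m : ℤ) + 1) - 1 = (i - 1) * (m + 1) + m by ring, ← Bool.not_eq_false,
      hx _ _ _ (by omega) le_rfl]
    rintro ⟨c, -, hc⟩
    have := hm c
    omega
  have hletter' : ∀ i j c, r i j = some c → IsLetter e x (i * (m + 1)) j c := by
    intro i j c hc
    have := hm c
    refine ⟨hlast i j, fun s hs => (hx _ _ _ (by omega) (by omega)).2 ⟨c, hc, by omega⟩, ?_⟩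
    rw [add_assoc, ← Bool.not_eq_false, hx _ _ _ (by omega) (by omega)]
    rintro ⟨c', hc', hle⟩
    obtain rfl : c = c' := by simpa [hc] using hc'
    omega
  have hletter : ∀ i j, letterAt e x (i * (m + 1)) j = r i j := by
    intro i j
    ext c
    rw [letterAt_eq_some he]
    refine ⟨fun h => ?_, hletter' i j c⟩
    obtain ⟨c', hc', -⟩ := (hx i 0 j le_rfl (by omega)).1 (by simpa using h.2.1 0 (by simp))
    rwa [h.unique he (hletter' i j c' hc')]
  refine ⟨x, funext fun ⟨a, b⟩ => ?_, ?_, ?_⟩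
  · cases hv : x (a, b) with
    | true => exact (hf _ _).2 (Or.inl (by simpa using hv))
    | false =>
      rw [← Bool.not_eq_true, hf]
      obtain ⟨i, s, h0, hs, rfl⟩ := hdecomp a
      obtain ⟨c, hc, hle⟩ := (hx _ _ _ h0 hs).1 hv
      rintro (h | ⟨h1, h2⟩)
      · simp [hv] at h
      · rcases h0.eq_or_lt with rfl | hpos
        · refine h2 c ?_ ?_
          · rw [← letterAt_eq_some he, ← hc, ← hletter]
            exact letterAt_congr hm fun s _ _ => by simp
          · convert hr i b c hc using 1
            · funext a d
              rw [← hletter]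
              exact letterAt_congr hm fun s _ _ => by
                simp only [Prod.mk_add_mk, add_zero]; congr 2; ring
            · rw [← hletter]
              exact letterAt_congr hm fun s _ _ => by
                simp only [Prod.mk_add_mk, add_zero, zero_add]; congr 2; ring
        · have : x (i * (m + 1) + (s - 1), b) = false :=
            (hx _ _ _ (by omega) (by omega)).2 ⟨c, hc, by omega⟩
          rw [← add_sub_assoc] at this
          simp [← sub_eq_add_neg, this] at h1
  · refine ((hfin.prod (Set.finite_Icc (0 : ℤ) m)).image
      fun q : (ℤ × ℤ) × ℤ => (q.1.1 * ((m : ℤ) + 1) + q.2, q.1.2)).subset ?_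
    rintro ⟨a, b⟩ hv
    obtain ⟨i, s, h0, hs, rfl⟩ := hdecomp a
    obtain ⟨c, hc, -⟩ := (hx _ _ _ h0 hs).1 hv
    exact ⟨((i, b), s), ⟨by simp [hc], h0, hs⟩, rfl⟩
  · obtain ⟨i, j, h⟩ := hne
    obtain ⟨c, hc⟩ := Option.ne_none_iff_exists'.1 h
    exact ⟨(i * (m + 1) + 0, j), (hx _ _ _ le_rfl (by omega)).2 ⟨c, hc, by omega⟩⟩

end RunCode

/-! ### Limits of orbits of freezing automata. -/

namespace CellularAutomaton

variable {f : CellularAutomaton}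

open Classical in
/-- The limit of the orbit of a configuration under a freezing cellular automaton. -/
noncomputable def limitConfig (f : CellularAutomaton) (x : Config) : Config :=
  fun v => decide (∃ n, f.step^[n] x v = true)

theorem limitConfig_eq_true {x : Config} {v : ℤ × ℤ} :
    f.limitConfig x v = true ↔ ∃ n, f.step^[n] x v = true := by
  simp [limitConfig]

theorem limitConfig_eq_false {x : Config} {v : ℤ × ℤ} :
    f.limitConfig x v = false ↔ ∀ n, f.step^[n] x v = false := by
  simp [limitConfig]

theorem Freezing.step_eq_true (hf : f.Freezing) {x : Config} {v : ℤ × ℤ} (h : x v = true) :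
    f.step x v = true :=
  (Bool.le_iff_imp.1 (hf x v)) h

theorem Freezing.iterate_eq_true_of_le (hf : f.Freezing) {x : Config} {v : ℤ × ℤ} {m n : ℕ}
    (hmn : m ≤ n) (h : f.step^[m] x v = true) : f.step^[n] x v = true := by
  induction hmn with
  | refl => exact h
  | step _ ih => rw [Nat.succ_eq_add_one, Function.iterate_succ_apply']; exact hf.step_eq_true ih

theorem Freezing.eventually_eq_limitConfig (hf : f.Freezing) (x : Config) (v : ℤ × ℤ) :
    ∀ᶠ n in atTop, f.step^[n] x v = f.limitConfig x v := by
  cases h : f.limitConfig x v with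
  | true =>
    obtain ⟨m, hm⟩ := limitConfig_eq_true.1 h
    exact eventually_atTop.2 ⟨m, fun n hn => hf.iterate_eq_true_of_le hn hm⟩
  | false => exact Eventually.of_forall (limitConfig_eq_false.1 h)

theorem Freezing.tendsto_limitConfig (hf : f.Freezing) (x : Config) :
    Tendsto (fun n => f.step^[n] x) atTop (𝓝 (f.limitConfig x)) :=
  tendsto_pi_nhds.2 fun v => tendsto_const_nhds.congr' <|
    (hf.eventually_eq_limitConfig x v).mono fun _ h => h.symm

theorem step_congr {x y : Config} {v : ℤ × ℤ} (h : ∀ n ∈ f.nbhd, x (v + n) = y (v + n)) :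
    f.step x v = f.step y v :=
  congrArg f.rule (funext fun n => h n.1 n.2)

/-- At some finite time the whole finite neighborhood of a cell has its limit values, and so does
the cell one step later. -/
theorem Freezing.step_limitConfig (hf : f.Freezing) (x : Config) :
    f.step (f.limitConfig x) = f.limitConfig x := by
  funext v
  have h1 : ∀ᶠ n in atTop, ∀ u ∈ f.nbhd, f.step^[n] x (v + u) = f.limitConfig x (v + u) :=
    (eventually_all_finset f.nbhd).2 fun u _ => hf.eventually_eq_limitConfig x (v + u)
  obtain ⟨n, h2, h3⟩ := (h1.and ((tendsto_add_atTop_nat 1).eventually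
    (hf.eventually_eq_limitConfig x v))).exists
  rw [← h3, Function.iterate_succ_apply']
  exact (step_congr h2).symm

theorem measurable_limitConfig (f : CellularAutomaton) : Measurable f.limitConfig := by
  refine measurable_pi_lambda _ fun v => measurable_to_bool ?_
  have : (fun x => f.limitConfig x v) ⁻¹' {true} =
      ⋃ n, (fun x => f.step^[n] x v) ⁻¹' {true} := by
    ext x; simp [limitConfig_eq_true]
  rw [this]
  exact MeasurableSet.iUnion fun n =>
    ((measurable_pi_apply v).comp (f.measurable_step.iterate n)) (measurableSet_singleton _)

/-- The law of the limit configuration. -/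
noncomputable def limitLaw (f : CellularAutomaton) (μ : ProbabilityMeasure Config) :
    ProbabilityMeasure Config :=
  μ.map f.measurable_limitConfig.aemeasurable

/-- Orbits converge pointwise, and dominated convergence carries this over to integrals of bounded
continuous functions. -/
theorem Freezing.tendsto_iterMap (hf : f.Freezing) (μ : ProbabilityMeasure Config) :
    Tendsto (fun n => f.iterMap n μ) atTop (𝓝 (f.limitLaw μ)) := by
  rw [ProbabilityMeasure.tendsto_iff_forall_integral_tendsto]
  intro g
  have hg : StronglyMeasurable g := g.continuous.measurable.stronglyMeasurable
  simp only [iterMap, limitLaw, ProbabilityMeasure.toMeasure_map]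
  rw [integral_map f.measurable_limitConfig.aemeasurable hg.aestronglyMeasurable]
  simp_rw [fun n => integral_map (μ := (μ : Measure Config))
    (f.measurable_step.iterate n).aemeasurable hg.aestronglyMeasurable]
  refine tendsto_integral_of_dominated_convergence (fun _ => ‖g‖)
    (fun n => (hg.comp_measurable (f.measurable_step.iterate n)).aestronglyMeasurable)
    (integrable_const _) (fun n => Eventually.of_forall fun x => g.norm_coe_le_norm _)
    (Eventually.of_forall fun x => ?_)
  exact (g.continuous.tendsto _).comp (hf.tendsto_limitConfig x)

theorem Freezing.limitSet_eq_support (hf : f.Freezing) (μ : ProbabilityMeasure Config) :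
    f.limitSet μ = (f.limitLaw μ : Measure Config).support := by
  have h : {ν : ProbabilityMeasure Config | MapClusterPt ν atTop fun n => f.iterMap n μ} =
      {f.limitLaw μ} := by
    ext ν
    refine ⟨fun hν => ?_, fun hν => hν ▸ (hf.tendsto_iterMap μ).mapClusterPt⟩
    have : (𝓝 ν ⊓ 𝓝 (f.limitLaw μ)).NeBot :=
      NeBot.mono hν (inf_le_inf_left _ (hf.tendsto_iterMap μ))
    exact eq_of_nhds_neBot this
  rw [limitSet, h, Set.biUnion_singleton, Measure.isClosed_support.closure_eq]

end CellularAutomaton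

/-! ### Trivialization of Bernoulli measures and finite fixed points. -/

theorem bernoulliConfig_pattern (p : unitInterval) (S : Finset (ℤ × ℤ)) (c : Config) :
    (bernoulliConfig p : Measure Config) {x | ∀ v ∈ S, x v = c v} =
      ∏ v ∈ S, if c v then (unitInterval.toNNReal p : ENNReal)
        else unitInterval.toNNReal (unitInterval.symm p) := by
  have h : {x : Config | ∀ v ∈ S, x v = c v} = Set.pi S fun v => {c v} := by
    ext x; simp [Set.mem_pi]
  rw [h]
  change Measure.infinitePi _ _ = _
  rw [Measure.infinitePi_pi _ fun _ _ => measurableSet_singleton _]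
  refine Finset.prod_congr rfl fun v _ => ?_
  rw [ProbabilityTheory.bernoulliMeasure_apply _ (measurableSet_singleton _)]
  cases c v <;> simp

theorem bernoulliConfig_pattern_pos {p : unitInterval} (h0 : 0 < p) (h1 : p < 1)
    (S : Finset (ℤ × ℤ)) (c : Config) :
    0 < (bernoulliConfig p : Measure Config) {x | ∀ v ∈ S, x v = c v} := by
  rw [bernoulliConfig_pattern, pos_iff_ne_zero, Finset.prod_ne_zero_iff]
  intro v _
  have e0 : (unitInterval.toNNReal p : ENNReal) ≠ 0 := by
    rw [Ne, ENNReal.coe_eq_zero, ← NNReal.coe_eq_zero]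
    exact (unitInterval.coe_pos.2 h0).ne'
  have e1 : (unitInterval.toNNReal (unitInterval.symm p) : ENNReal) ≠ 0 := by
    rw [Ne, ENNReal.coe_eq_zero, ← NNReal.coe_eq_zero]
    exact (sub_pos.2 (unitInterval.coe_lt_one.2 h1)).ne'
  split_ifs <;> assumption

namespace CellularAutomaton

variable {f : CellularAutomaton}

/-- If a freezing cellular automaton has a fixed point with finitely many zeros, at least one, then
the zeros of every configuration that contains a copy of it persist. -/
theorem Freezing.limitConfig_eq_false_of_pattern (hf : f.Freezing) {z : Config}
    (hz : f.step z = z) {x : Config}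
    (hx : ∀ v, z v = false → x v = false ∧ ∀ n ∈ f.nbhd, x (v + n) = z (v + n))
    {v : ℤ × ℤ} (hv : z v = false) : f.limitConfig x v = false := by
  -- Agreement with `z` around each of its zeros is carried along: ones there persist by freezing,
  -- and zeros there are again zeros of `z`.
  have key : ∀ n, ∀ v, z v = false → f.step^[n] x v = false ∧
      ∀ u ∈ f.nbhd, f.step^[n] x (v + u) = z (v + u) := by
    intro n
    induction n with
    | zero => exact hx
    | succ n ih =>
      have h0 : ∀ v, z v = false → f.step^[n + 1] x v = false := fun v hv => by
        rw [Function.iterate_succ_apply', step_congr (ih v hv).2, hz, hv]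
      refine fun v hv => ⟨h0 v hv, fun u hu => ?_⟩
      cases h : z (v + u) with
      | true =>
        refine hf.iterate_eq_true_of_le (Nat.zero_le _) ?_
        rw [← h]; exact (hx v hv).2 u hu
      | false => exact h0 _ h
  exact limitConfig_eq_false.2 fun n => (key n v hv).1

/-- At a zero `v` of `z` the limit is 1 when `v` starts as 1, and 0 when the start agrees with `z`
on its zeros and their neighborhoods. Both events have positive measure, so the support is not a
single point. -/
theorem Freezing.not_trivializes (hf : f.Freezing) {z : Config} (hz : f.step z = z)
    (hfin : {v | z v = false}.Finite) (hne : {v | z v = false}.Nonempty) {p : unitInterval}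
    (h0 : 0 < p) (h1 : p < 1) : ¬ f.Trivializes (bernoulliConfig p) := by
  classical
  intro htriv
  rw [Trivializes, hf.limitSet_eq_support, Set.encard_eq_one] at htriv
  obtain ⟨y, hy⟩ := htriv
  obtain ⟨v, hv⟩ := hne
  have hval : ∀ b : Bool, 0 < (bernoulliConfig p : Measure Config) {x | f.limitConfig x v = b} →
      y v = b := by
    intro b hb
    have hb' : 0 < (f.limitLaw (bernoulliConfig p) : Measure Config) {x | x v = b} := by
      have hm : MeasurableSet {x : Config | x v = b} :=
        measurableSet_eq_fun (measurable_pi_apply v) measurable_const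
      rw [limitLaw, ProbabilityMeasure.toMeasure_map,
        Measure.map_apply f.measurable_limitConfig hm]
      exact hb
    obtain ⟨x, hx, hxs⟩ := Measure.nonempty_inter_support_of_pos hb'
    rw [hy] at hxs
    obtain rfl : x = y := hxs
    exact hx
  have ht : y v = true := by
    refine hval true ((bernoulliConfig_pattern_pos h0 h1 {v} fun _ => true).trans_le
      (measure_mono fun x hx => ?_))
    exact limitConfig_eq_true.2 ⟨0, hx v (by simp)⟩
  have hf' : y v = false := by
    refine hval false ((bernoulliConfig_pattern_pos h0 h1 (hfin.toFinset ∪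
      (hfin.toFinset ×ˢ f.nbhd).image fun q => q.1 + q.2) z).trans_le
      (measure_mono fun x hx => ?_))
    refine hf.limitConfig_eq_false_of_pattern hz (fun u hu => ⟨?_, fun n hn => ?_⟩) hv
    · rw [hx u (by simp only [Finset.mem_union]; left; simpa using hu)]
      exact hu
    · refine hx _ ?_
      rw [Finset.mem_union]
      right
      exact Finset.mem_image.2 ⟨(u, n), by simpa using ⟨hu, hn⟩, rfl⟩
  simp [ht] at hf'

open Classical in
/-- The pairs of the end point and the set of cells of a self-avoiding path of length `k` from `v`
with steps in the neighborhood. -/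
noncomputable def paths (f : CellularAutomaton) (v : ℤ × ℤ) :
    ℕ → Finset ((ℤ × ℤ) × Finset (ℤ × ℤ))
  | 0 => {(v, {v})}
  | k + 1 => ((paths f v k ×ˢ f.nbhd).filter fun q => q.1.1 + q.2 ∉ q.1.2).image
      fun q => (q.1.1 + q.2, insert (q.1.1 + q.2) q.1.2)

theorem card_paths_le (f : CellularAutomaton) (v : ℤ × ℤ) (k : ℕ) :
    (f.paths v k).card ≤ f.nbhd.card ^ k := by
  classical
  induction k with
  | zero => simp [paths]
  | succ k ih =>
    rw [paths]
    refine Finset.card_image_le.trans ((Finset.card_filter_le _ _).trans ?_)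
    rw [Finset.card_product, pow_succ]
    exact Nat.mul_le_mul_right _ ih

theorem card_eq_of_mem_paths {v : ℤ × ℤ} {k : ℕ} {q : (ℤ × ℤ) × Finset (ℤ × ℤ)}
    (h : q ∈ f.paths v k) : q.2.card = k + 1 := by
  classical
  induction k generalizing q with
  | zero => obtain rfl : q = (v, {v}) := by simpa [paths] using h
            simp
  | succ k ih =>
    obtain ⟨⟨q', n⟩, hq, rfl⟩ := Finset.mem_image.1 h
    obtain ⟨h1, h2⟩ := Finset.mem_filter.1 hq
    simp only at h2 ⊢
    rw [Finset.card_insert_of_notMem h2, ih (Finset.mem_product.1 h1).1]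

open Classical in
/-- The zeros of `y` that can be reached from `v` by at most `k` steps between zeros. -/
noncomputable def zeroBall (f : CellularAutomaton) (y : Config) (v : ℤ × ℤ) :
    ℕ → Finset (ℤ × ℤ)
  | 0 => {v}
  | k + 1 => zeroBall f y v k ∪
      ((zeroBall f y v k ×ˢ f.nbhd).image fun q => q.1 + q.2).filter fun u => y u = false

theorem mem_zeroBall_succ {y : Config} {v u : ℤ × ℤ} {k : ℕ} : u ∈ f.zeroBall y v (k + 1) ↔
    u ∈ f.zeroBall y v k ∨ ∃ w ∈ f.zeroBall y v k, ∃ n ∈ f.nbhd, w + n = u ∧ y u = false := by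
  simp only [zeroBall, Finset.mem_union, Finset.mem_filter, Finset.mem_image, Finset.mem_product]
  refine or_congr_right ⟨?_, ?_⟩
  · rintro ⟨⟨⟨w, n⟩, ⟨hw, hn⟩, h⟩, hu⟩
    exact ⟨w, hw, n, hn, h, hu⟩
  · rintro ⟨w, hw, n, hn, h, hu⟩
    exact ⟨⟨(w, n), ⟨hw, hn⟩, h⟩, hu⟩

theorem zeroBall_mono {y : Config} {v : ℤ × ℤ} : Monotone (f.zeroBall y v) :=
  monotone_nat_of_le_succ fun _ _ h => mem_zeroBall_succ.2 (Or.inl h)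

theorem eq_false_of_mem_zeroBall {y : Config} {v : ℤ × ℤ} (hv : y v = false) {k : ℕ} {u : ℤ × ℤ}
    (h : u ∈ f.zeroBall y v k) : y u = false := by
  induction k generalizing u with
  | zero => obtain rfl : u = v := by simpa [zeroBall] using h
            exact hv
  | succ k ih =>
    rcases mem_zeroBall_succ.1 h with h | ⟨_, _, _, _, _, h⟩
    exacts [ih h, h]

/-- A cell at distance exactly `k` is the end point of a self-avoiding path of zeros. -/
theorem exists_mem_paths {y : Config} {v : ℤ × ℤ} (k : ℕ) (u : ℤ × ℤ) (hu : u ∈ f.zeroBall y v k)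
    (hlt : ∀ j < k, u ∉ f.zeroBall y v j) :
    ∃ S, (u, S) ∈ f.paths v k ∧ S ⊆ f.zeroBall y v k := by
  classical
  induction k generalizing u with
  | zero =>
    obtain rfl : u = v := by simpa [zeroBall] using hu
    exact ⟨{u}, by simp [paths], by simp [zeroBall]⟩
  | succ k ih =>
    obtain h | ⟨w, hw, n, hn, rfl, hy⟩ := mem_zeroBall_succ.1 hu
    · exact absurd h (hlt k (by omega))
    · obtain ⟨S, hS, hsub⟩ := ih w hw fun j hj hwj =>
        hlt (j + 1) (by omega) (mem_zeroBall_succ.2 (Or.inr ⟨w, hwj, n, hn, rfl, hy⟩))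
      refine ⟨insert (w + n) S, Finset.mem_image.2 ⟨((w, S), n), Finset.mem_filter.2
        ⟨Finset.mem_product.2 ⟨hS, hn⟩, fun h => hlt k (by omega) (hsub h)⟩, rfl⟩, ?_⟩
      exact Finset.insert_subset hu (hsub.trans (zeroBall_mono (Nat.le_succ k)))

/-- If no fixed point has finitely many zeros, at least one, then every zero of a fixed point
starts self-avoiding paths of zeros of every length. -/
theorem Freezing.exists_path_of_fixedPoint (hf : f.Freezing)
    (hno : ∀ z : Config, f.step z = z → {v | z v = false}.Finite → ¬ {v | z v = false}.Nonempty)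
    {y : Config} (hy : f.step y = y) {v : ℤ × ℤ} (hv : y v = false) (k : ℕ) :
    ∃ q ∈ f.paths v k, ∀ u ∈ q.2, y u = false := by
  classical
  -- If the ball stopped growing, its cells would be the zeros of a fixed point: each of them sees
  -- the same neighborhood as in `y`, and the ones outside persist by freezing.
  have hgrow : ∀ k, ¬ f.zeroBall y v (k + 1) ⊆ f.zeroBall y v k := by
    intro k hsub
    let z : Config := fun u => !decide (u ∈ f.zeroBall y v k)
    have hz : ∀ u, z u = false ↔ u ∈ f.zeroBall y v k := by simp [z]
    refine hno z (funext fun u => ?_) ?_ ⟨v, (hz v).2 (zeroBall_mono (Nat.zero_le k) ?_)⟩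
    · cases hu : z u with
      | true => exact hf.step_eq_true hu
      | false =>
        have hu' := (hz u).1 hu
        rw [← eq_false_of_mem_zeroBall hv hu', ← congrFun hy u]
        refine step_congr fun n hn => ?_
        cases hyn : y (u + n) with
        | false =>
          exact (hz _).2 (hsub (mem_zeroBall_succ.2 (Or.inr ⟨u, hu', n, hn, rfl, hyn⟩)))
        | true =>
          by_contra h
          have := eq_false_of_mem_zeroBall hv ((hz _).1 (Bool.eq_false_of_not_eq_true h))
          simp [hyn] at this
    · exact (f.zeroBall y v k).finite_toSet.subset fun u hu => (hz u).1 hu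
    · simp [zeroBall]
  have hex : ∃ u ∈ f.zeroBall y v k, ∀ j < k, u ∉ f.zeroBall y v j := by
    cases k with
    | zero => exact ⟨v, by simp [zeroBall], by simp⟩
    | succ k =>
      obtain ⟨u, h1, h2⟩ := Finset.not_subset.1 (hgrow k)
      exact ⟨u, h1, fun j hj h => h2 (zeroBall_mono (by omega) h)⟩
  obtain ⟨u, hu, hlt⟩ := hex
  obtain ⟨S, hS, hsub⟩ := exists_mem_paths k u hu hlt
  exact ⟨_, hS, fun w hw => eq_false_of_mem_zeroBall hv (hsub hw)⟩

/-- Zeros of the limit are zeros of the initial configuration. At most `f.nbhd.card ^ k` paths have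
`k` steps, and each has `k + 1` distinct cells, all zero with probability `q ^ (k + 1)`. -/
theorem Freezing.measure_limitConfig_eq_false (hf : f.Freezing)
    (hno : ∀ z : Config, f.step z = z → {v | z v = false}.Finite → ¬ {v | z v = false}.Nonempty)
    {p : unitInterval}
    (hp : f.nbhd.card * (unitInterval.toNNReal (unitInterval.symm p) : ENNReal) ≤ 2⁻¹)
    (v : ℤ × ℤ) :
    (bernoulliConfig p : Measure Config) {x | f.limitConfig x v = false} = 0 := by
  set q : ENNReal := ENNReal.ofNNReal (unitInterval.toNNReal (unitInterval.symm p)) with hq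
  have hq1 : q ≤ 1 := by
    rw [hq, ENNReal.coe_le_one_iff]
    exact (unitInterval.symm p).2.2
  have hbound : ∀ k : ℕ, (bernoulliConfig p : Measure Config) {x | f.limitConfig x v = false} ≤
      2⁻¹ ^ k := by
    intro k
    have hsub : {x | f.limitConfig x v = false} ⊆
        ⋃ r ∈ f.paths v k, {x : Config | ∀ u ∈ r.2, x u = false} := by
      intro x hx
      obtain ⟨r, hr, h⟩ := hf.exists_path_of_fixedPoint hno (hf.step_limitConfig x) hx k
      exact Set.mem_biUnion (Finset.mem_coe.2 hr) fun u hu => limitConfig_eq_false.1 (h u hu) 0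
    calc (bernoulliConfig p : Measure Config) {x | f.limitConfig x v = false}
        ≤ ∑ r ∈ f.paths v k, (bernoulliConfig p : Measure Config) {x | ∀ u ∈ r.2, x u = false} :=
          (measure_mono hsub).trans (measure_biUnion_finset_le _ _)
      _ = ∑ r ∈ f.paths v k, q ^ (k + 1) := by
          refine Finset.sum_congr rfl fun r hr => ?_
          rw [bernoulliConfig_pattern p r.2 fun _ => false]
          simp [card_eq_of_mem_paths hr, hq]
      _ ≤ (f.nbhd.card : ENNReal) ^ k * q ^ k := by
          rw [Finset.sum_const, nsmul_eq_mul, pow_succ]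
          refine mul_le_mul' (by exact_mod_cast card_paths_le f v k) ?_
          exact mul_le_of_le_one_right' hq1
      _ ≤ 2⁻¹ ^ k := by rw [← mul_pow]; exact pow_le_pow_left' hp k
  exact le_antisymm (ge_of_tendsto' (ENNReal.tendsto_pow_atTop_nhds_zero_of_lt_one
    (by simp)) hbound) zero_le

theorem Freezing.trivializesSomeBernoulli (hf : f.Freezing)
    (hno : ∀ z : Config, f.step z = z → {v | z v = false}.Finite →
      ¬ {v | z v = false}.Nonempty) : f.TrivializesSomeBernoulli := by
  have hN : (0 : ℝ) < 2 * (f.nbhd.card + 1) := by positivity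
  -- The probability of a zero. The summand 1 keeps it strictly between 0 and 1 even for an empty
  -- neighborhood.
  set a : ℝ := (2 * (f.nbhd.card + 1))⁻¹ with ha
  have ha0 : 0 < a := inv_pos.2 hN
  have ha1 : a < 1 := inv_lt_one_of_one_lt₀ (by linarith [(Nat.cast_nonneg f.nbhd.card : (0 : ℝ) ≤ _)])
  let p : unitInterval := ⟨1 - a, by linarith, by linarith⟩
  refine ⟨p, ?_, ?_, ?_⟩
  · exact unitInterval.coe_pos.1 (sub_pos.2 ha1)
  · exact unitInterval.coe_lt_one.1 (sub_lt_self 1 ha0)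
  have hp : f.nbhd.card * (unitInterval.toNNReal (unitInterval.symm p) : ENNReal) ≤ 2⁻¹ := by
    have h : (f.nbhd.card : NNReal) * unitInterval.toNNReal (unitInterval.symm p) ≤ 2⁻¹ := by
      rw [← NNReal.coe_le_coe]
      have : ((unitInterval.toNNReal (unitInterval.symm p) : NNReal) : ℝ) = a := by
        simp [p]
      rw [NNReal.coe_mul, this, ha]
      push_cast
      rw [← div_eq_mul_inv, div_le_iff₀ hN]
      linarith
    have := ENNReal.coe_le_coe.2 h
    rwa [ENNReal.coe_mul, ENNReal.coe_natCast, ENNReal.coe_inv (by norm_num)] at this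
  have hae : f.limitConfig =ᵐ[(bernoulliConfig p : Measure Config)] fun _ _ => true := by
    have : ∀ᵐ x ∂(bernoulliConfig p : Measure Config), ∀ v, f.limitConfig x v = true := by
      rw [ae_all_iff]
      intro v
      rw [ae_iff]
      simpa using hf.measure_limitConfig_eq_false hno hp v
    exact this.mono fun x hx => funext hx
  have hlaw : (f.limitLaw (bernoulliConfig p) : Measure Config) = Measure.dirac fun _ => true := by
    rw [limitLaw, ProbabilityMeasure.toMeasure_map, Measure.map_congr hae, Measure.map_const]
    simp
  rw [Trivializes, hf.limitSet_eq_support, hlaw, Set.encard_eq_one]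
  refine ⟨fun _ => true, Set.Subset.antisymm ?_ ?_⟩
  · refine Measure.support_subset_of_isClosed isClosed_singleton ?_
    rw [mem_ae_dirac_iff]
    · rfl
    · exact measurableSet_singleton _
  · rintro _ rfl
    rw [Measure.mem_support_iff_forall]
    intro U hU
    rw [Measure.dirac_apply_of_mem (mem_of_mem_nhds hU)]
    exact one_pos

end CellularAutomaton

/-! ### Computability of the reduction and conclusion. -/

theorem Primrec.int_negSucc : Primrec Int.negSucc := by
  refine Primrec.encode_iff.1 ((Primrec.nat_add.comp (Primrec.nat_mul.comp (Primrec.const 2)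
    Primrec.id) (Primrec.const 1)).of_eq fun k => ?_)
  rfl

/-- The bound on `s` makes the displacement negative for every `n`, so it is `Int.negSucc` of an
affine function of `n` with natural coefficients. -/
theorem Primrec.int_sub_mul {m : ℕ} {s : ℤ} (hs : s < m + 1) :
    Primrec fun n : ℕ => s - ((n : ℤ) + 1) * (m + 1) := by
  refine (Primrec.int_negSucc.comp (Primrec.nat_add.comp (Primrec.nat_mul.comp Primrec.id
    (Primrec.const (m + 1))) (Primrec.const (m - s).toNat))).of_eq fun n => ?_
  rw [Int.negSucc_eq]
  push_cast
  rw [Int.toNat_of_nonneg (by omega), id]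
  ring

theorem Primrec.list_map_const {α β γ : Type*} [Primcodable α] [Primcodable γ]
    {h : α → β → γ} {L : List β} (hL : ∀ b ∈ L, Primrec fun a => h a b) :
    Primrec fun a => L.map (h a) := by
  induction L with
  | nil => exact Primrec.const []
  | cons b L ih =>
    exact Primrec.list_cons.comp (hL b (by simp)) (ih fun b hb => hL b (by simp [hb]))

/-- An undecidable predicate does not reduce to a problem that is decidable on the image of the
reduction. -/
theorem not_decidableOn_of_reduction {α β : Type*} [Primcodable α] [Primcodable β] {I : Set α}
    {P : α → Prop} {p : β → Prop} (hp : ¬ ComputablePred p) {g : β → α} (hg : Computable g)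
    (hI : ∀ n, g n ∈ I) (h : ∀ n, P (g n) ↔ p n) : ¬ DecidableOn I P := by
  rintro ⟨D, hD, hDP⟩
  choose b hb hbP using fun n => hDP (g n) (hI n)
  refine hp (ComputablePred.computable_iff.2 ⟨b, ?_, funext fun n => propext ?_⟩)
  · exact (hD.comp hg).of_eq fun n => Part.eq_some_iff.2 (hb n)
  · exact ((hbP n).trans (h n)).symm

/-- There is a primitive recursive sequence of descriptions of freezing cellular automata for which
it is undecidable whether there is a fixed point with finitely many zeros, at least one. -/
theorem exists_codes_fixedPoint_undecidable :
    ∃ g : ℕ → CACode, Primrec g ∧ (∀ n, (g n).toCA.Freezing) ∧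
      ¬ ComputablePred fun n => ∃ x, (g n).toCA.step x = x ∧ {v | x v = false}.Finite ∧
        {v | x v = false}.Nonempty := by
  obtain ⟨A, _, F, H, b, x, y, hH, hund⟩ := exists_rowRun_undecidable
  let e : PicLetter A → ℕ := fun c => Finite.equivFin _ c
  have he : Function.Injective e := Fin.val_injective.comp (Finite.equivFin _).injective
  have hm : ∀ c, e c < Nat.card (PicLetter A) := fun c => (Finite.equivFin _ c).2
  obtain ⟨L₀, L₁, T, hL₁, hstep⟩ := RunCode.exists_words he hm (PicLetter.Correct F H b x y)
    fun _ _ _ _ => PicLetter.Correct.congr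
  set m := Nat.card (PicLetter A)
  refine ⟨fun n => (L₀ ++ L₁.map fun s => (s - ((n : ℤ) + 1) * (m + 1), (0 : ℤ)), T), ?_,
    fun n x v => ?_, fun hc => hund (hc.of_eq fun n => ⟨?_, ?_⟩)⟩
  · exact (Primrec.list_append.comp (Primrec.const L₀) (Primrec.list_map_const fun s hs =>
      (Primrec.int_sub_mul (hL₁ s hs)).pair (Primrec.const 0))).pair (Primrec.const T)
  · exact Bool.le_iff_imp.2 fun hv => (hstep n x v).2 (Or.inl ((congrArg x (add_zero v)).trans hv))
  · rintro ⟨z, hz, hfin, hne⟩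
    obtain ⟨r, h1, h2, h3⟩ :=
      RunCode.exists_picture_of_fixedPoint he hm (hstep n) hz hfin hne
    exact IsCorrectPicture.exists_mem ⟨h1, h2, h3⟩
  · rintro ⟨t, i, h⟩
    obtain ⟨r, hr⟩ := exists_isCorrectPicture hH h
    exact RunCode.exists_fixedPoint_of_picture he hm (hstep n) hr.finite hr.nonempty hr.correct

theorem mainTheorem3 :
    ¬ DecidableOn {c : CACode | c.toCA.Freezing} (fun c => c.toCA.TrivializesSomeBernoulli) := by
  obtain ⟨g, hg, hfr, hund⟩ := exists_codes_fixedPoint_undecidable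
  -- Trivialization means absence of the fixed point, so it is the complement of the undecidable
  -- predicate that is reduced.
  refine not_decidableOn_of_reduction (fun h => hund (h.not.of_eq fun n => not_not)) hg.to_comp hfr
    fun n => ⟨?_, fun hno => ?_⟩
  · rintro ⟨p, h0, h1, htriv⟩ ⟨z, hz, hfin, hne⟩
    exact (hfr n).not_trivializes hz hfin hne h0 h1 htriv
  · exact (hfr n).trivializesSomeBernoulli fun z hz hfin hne => hno ⟨z, hz, hfin, hne⟩
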